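/- Let $f=f_X$ be a probability density on $\mathbb R$, let $X,X_1,X_2,\dots$ be i.i.d. with density $f$, $S_n=X_1+\cdots+X_n$, and let $f_n$ be the density of $S_n$, so $f_1=f$ and $f_{n+1}=f*f_n$ (convolution). Put $M_X(t)=\mathbb E[e^{tX}]$, $\Lambda(t)=\log M_X(t)\in(-\infty,\infty]$ for $t\in\mathbb R$, and let $(A_\Lambda,B_\Lambda)$ be the interior of $\{t:\Lambda(t)<\infty\}$; for complex $z$ with $A_\Lambda<\operatorname{Re}z<B_\Lambda$ put $M_X(z)=\mathbb E[e^{zX}]$. Consider the following assumptions. - **C1.** There are $-\infty\le\alpha<\beta\le\infty$ such that $f$ is positive and continuous on $(\alpha,\beta)$ and zero outside it, and $f|_{(\alpha,\beta)}$ extends continuously to $\alpha$ if $\alpha>-\infty$ and to $\beta$ if $\beta<\infty$. - **C2.** $\mathbb E[e^{\lambda|X|}]<\infty$ for some $\lambda>0$. - **C3.** $\Lambda$ is lower semicontinuous on $\mathbb R$. - **C4.** For all $A_\Lambda<s<t<B_\Lambda$ there are $K,p>0$ with $|M_X(z)|\le K(1+|\operatorname{Im}z|)^{-p}$ whenever $s\le\operatorname{Re}z\le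 t$. - **C5.** There are $L,D,d>0$ such that $f\le L$ on $\mathbb R$, and $f(x)\le De^{-dx^2}$ for all $x\ge0$ or $f(x)\le De^{-dx^2}$ for all $x\le0$. - **C6.** There are functions $\hat a,\hat C:(0,\infty)\to(0,\infty)$ such that for all $n\ge1$, $z\in(n\alpha,n\beta)$ and $\hat b>0$ $$\mathbb E\Big[\exp\Big(\hat a(\hat b)\max_{1\le k\le n}|S_k|\Big)\,\Big|\,S_n=z\Big]\le\hat C(\hat b)\,e^{\hat b(n+z^2/n)}.\tag{1}$$ Here conditioning on $S_n=z$ means that $(X_1,\dots,X_{n-1})$ has density $f(x_1)\cdots f(x_{n-1})\,f(z-x_1-\cdots-x_{n-1})/f_n(z)$ and $X_n=z-X_1-\cdots-X_{n-1}$. A function $g$ on $\mathbb R$ is *unimodal* if for some real $M$ it is nondecreasing on $(-\infty,M]$ and nonincreasing on $[M,\infty)$; $f$ is *strongly unimodal* if $f*h$ is unimodal for every continuous unimodal probability density $h$. **Lemma.** Let $f$ satisfy C1–C5. Then $f$ satisfies C6 if at least one of the following holds: $\alpha>-\infty$; $\beta<\infty$; $\alpha=-\infty$, $\beta=\infty$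 and $f$ is strongly unimodal. Moreover: 1. If $\alpha>-\infty$, then (1) holds with $\hat a(\hat b)=\hat b/(1+\hat b+|\alpha|)$ and $\hat C(\hat b)=1$. 2. If $\beta<\infty$, then (1) holds with $\hat a(\hat b)=\hat b/(1+\hat b+|\beta|)$ and $\hat C(\hat b)=1$. 3. Let $\alpha=-\infty$, $\beta=\infty$ and $f$ be strongly unimodal. Let $\lambda$ be any constant as in C2 and $L$ any constant as in C5, and let $\mu=\mathbb E[X]$. Then there are constants $\Delta,R,C_R,c_R>0$ and $\hat C_R,\hat c_R$ such that $R>|\mu|+1+\Delta^{-1}$ and, for all $n\ge1$, $$\inf_{x\in[-1,1]}f_n(n\mu+x)\ge n^{-1/2}\Delta,\qquad f_n(nz)\ge C_Rn^{-1/2}e^{-c_Rn}\ \text{ for } z\in[-2R,2R],$$ $$\mathbb E[e^{\lambda|X|}]^n\Big[\frac{4n^{3/2}}{\Delta}+LC_R^{-1}\sqrt n\,e^{c_Rn}\Big]\le\hat C_Re^{\hat c_Rn}.$$ For any such constants, (1) holds with $\hat a(\hat b)=\lambda/v$ and $\hat C(\hat b)=\hat C_R^{1/v}$, where, for each $\hat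 b>0$, $v=v(\hat b)$ is any positive integer with $\hat c_R/v\le\hat b/2$ and $\lambda/v\le\hat b/2$. -/

import Mathlib

open MeasureTheory Filter Topology Set

noncomputable section

namespace RWBridge

/-- `f` is a probability density on `ℝ` with respect to Lebesgue measure. -/
structure IsProbDensity (f : ℝ → ℝ) : Prop where
  measurable : Measurable f
  nonneg : ∀ x, 0 ≤ f x
  lintegral_eq_one : ∫⁻ x, ENNReal.ofReal (f x) = 1

/-- The convolution `(f * g)(x) = ∫ f(t) g(x - t) dt`. -/
def conv (f g : ℝ → ℝ) : ℝ → ℝ :=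
  MeasureTheory.convolution f g (ContinuousLinearMap.mul ℝ ℝ) volume

/-- `sumDensity f n` is the density `f_n` of `S_n = X_1 + ⋯ + X_n`, where the `X_i` are i.i.d.
with density `f`; thus `f_1 = f` and `f_{n+1} = f * f_n`. It is used for `n ≥ 1` only (`S_0 = 0`
has no density, and the value at `n = 0` is a dummy). -/
def sumDensity (f : ℝ → ℝ) : ℕ → ℝ → ℝ
  | 0 => 0
  | 1 => f
  | n + 2 => conv f (sumDensity f (n + 1))

/-- The moment generating function `M_X(t) = E[exp (t X)] ∈ [0, ∞]` at real `t`. -/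
def momentGen (f : ℝ → ℝ) (t : ℝ) : ENNReal :=
  ∫⁻ x, ENNReal.ofReal (Real.exp (t * x) * f x)

/-- `Λ(t) = log M_X(t)`, which is `+∞` where `M_X(t) = ∞`. -/
def logMomentGen (f : ℝ → ℝ) (t : ℝ) : EReal :=
  ENNReal.log (momentGen f t)

/-- The domain `D_Λ = {t : Λ(t) < ∞}`. Its interior is the open interval `(A_Λ, B_Λ)`. -/
def domainΛ (f : ℝ → ℝ) : Set ℝ := {t | logMomentGen f t < ⊤}

/-- The moment generating function at complex arguments, `M_X(z) = E[exp (z X)]`. It is used only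
for `Re z ∈ (A_Λ, B_Λ)`, where the integral converges absolutely and gives the analytic
extension of the real moment generating function. -/
def complexMomentGen (f : ℝ → ℝ) (z : ℂ) : ℂ :=
  ∫ x : ℝ, Complex.exp (z * x) * (f x : ℂ)

/-- The mean `μ = E[X]`. -/
def mean (f : ℝ → ℝ) : ℝ := ∫ x, x * f x

/-! ### The assumptions -/

/-- Assumption C1, with `-∞ ≤ α < β ≤ ∞`. -/
structure AssumptionC1 (f : ℝ → ℝ) (α β : EReal) : Prop where
  lt : α < β
  pos : ∀ x : ℝ, α < (x : EReal) → (x : EReal) < β → 0 < f x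
  continuousOn : ContinuousOn f {x : ℝ | α < (x : EReal) ∧ (x : EReal) < β}
  zero_outside : ∀ x : ℝ, ¬ (α < (x : EReal) ∧ (x : EReal) < β) → f x = 0
  extends_left : ∀ a : ℝ, α = (a : EReal) → ∃ l : ℝ, Tendsto f (𝓝[>] a) (𝓝 l)
  extends_right : ∀ b : ℝ, β = (b : EReal) → ∃ l : ℝ, Tendsto f (𝓝[<] b) (𝓝 l)

/-- `lam > 0` is an admissible constant in Assumption C2: `E[exp (lam |X|)] < ∞`. -/
def AssumptionC2With (f : ℝ → ℝ) (lam : ℝ) : Prop :=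
  0 < lam ∧ ∫⁻ x, ENNReal.ofReal (Real.exp (lam * |x|) * f x) < ⊤

def AssumptionC2 (f : ℝ → ℝ) : Prop := ∃ lam, AssumptionC2With f lam

def AssumptionC3 (f : ℝ → ℝ) : Prop := LowerSemicontinuous (logMomentGen f)

def AssumptionC4 (f : ℝ → ℝ) : Prop :=
  ∀ s t : ℝ, s ∈ interior (domainΛ f) → t ∈ interior (domainΛ f) → s < t →
    ∃ K p : ℝ, 0 < K ∧ 0 < p ∧ ∀ z : ℂ, s ≤ z.re → z.re ≤ t →
      ‖complexMomentGen f z‖ ≤ K / (1 + |z.im|) ^ p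

/-- `L` is an admissible upper bound in Assumption C5. -/
def AssumptionC5With (f : ℝ → ℝ) (L : ℝ) : Prop :=
  0 < L ∧ (∀ x, f x ≤ L) ∧ ∃ D d : ℝ, 0 < D ∧ 0 < d ∧
    ((∀ x, 0 ≤ x → f x ≤ D * Real.exp (-d * x ^ 2)) ∨
      (∀ x, x ≤ 0 → f x ≤ D * Real.exp (-d * x ^ 2)))

def AssumptionC5 (f : ℝ → ℝ) : Prop := ∃ L, AssumptionC5With f L

/-! ### The random walk bridge -/

/-- `L_n = (n α, n β)`. -/
def endpoints (α β : EReal) (n : ℕ) : Set ℝ :=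
  {z : ℝ | (n : EReal) * α < (z : EReal) ∧ (z : EReal) < (n : EReal) * β}

/-- The position `S_k`, `0 ≤ k ≤ n`, of an `n`-step walk whose first `n - 1` steps are the
coordinates of `x` and which ends at `S_n = z`. -/
def walkPos (n : ℕ) (z : ℝ) (x : Fin (n - 1) → ℝ) (k : ℕ) : ℝ :=
  if k < n then ∑ i : Fin (n - 1) with i.val < k, x i else z

/-- The law of the bridge `S^{(n,z)}`, i.e. of the walk conditioned on `S_n = z`, described by its
first `n - 1` steps `(X_1, …, X_{n-1})` (the last step is `z - X_1 - ⋯ - X_{n-1}`). Its density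
is the conditional density
`f(x_1) ⋯ f(x_{n-1}) f(z - x_1 - ⋯ - x_{n-1}) / f_n(z)`. -/
def bridgeLaw (f : ℝ → ℝ) (n : ℕ) (z : ℝ) : Measure (Fin (n - 1) → ℝ) :=
  volume.withDensity fun x =>
    ENNReal.ofReal ((∏ i, f (x i)) * f (z - ∑ i, x i) / sumDensity f n z)

/-- `E[exp (a max_{1 ≤ k ≤ n} |S_k|) | S_n = z] ∈ [0, ∞]`. -/
def bridgeExpMax (f : ℝ → ℝ) (n : ℕ) (z a : ℝ) : ENNReal :=
  ∫⁻ x, ENNReal.ofReal (Real.exp (a * ⨆ k : Fin n, |walkPos n z x (k.val + 1)|))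
    ∂(bridgeLaw f n z)

/-- Assumption C6 holds with the functions `aHat` and `CHat` on `(0, ∞)` (their values at
nonpositive arguments play no role). -/
def AssumptionC6With (f : ℝ → ℝ) (α β : EReal) (aHat CHat : ℝ → ℝ) : Prop :=
  (∀ b, 0 < b → 0 < aHat b ∧ 0 < CHat b) ∧
    ∀ n : ℕ, 1 ≤ n → ∀ z ∈ endpoints α β n, ∀ b : ℝ, 0 < b →
      bridgeExpMax f n z (aHat b) ≤
        ENNReal.ofReal (CHat b * Real.exp (b * (n + z ^ 2 / n)))

def AssumptionC6 (f : ℝ → ℝ) (α β : EReal) : Prop :=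
  ∃ aHat CHat : ℝ → ℝ, AssumptionC6With f α β aHat CHat

/-! ### Unimodality -/

def Unimodal (f : ℝ → ℝ) : Prop := ∃ M : ℝ, MonotoneOn f (Iic M) ∧ AntitoneOn f (Ici M)

/-- The convolution of `f` with every continuous unimodal probability density is unimodal. -/
def StronglyUnimodal (f : ℝ → ℝ) : Prop :=
  ∀ h : ℝ → ℝ, IsProbDensity h → Continuous h → Unimodal h → Unimodal (conv f h)

/-- The constants `Δ, R, C_R, c_R, Ĉ_R, ĉ_R` attached to a density with full support, to `lam` as
in Assumption C2 and to `L` as in Assumption C5. -/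
structure UnimodalConstants (f : ℝ → ℝ) (lam L Δ R C c CHat cHat : ℝ) : Prop where
  Δ_pos : 0 < Δ
  center_lower : ∀ n : ℕ, 1 ≤ n → ∀ x ∈ Icc (-1 : ℝ) 1,
    Δ / √(n : ℝ) ≤ sumDensity f n (n * mean f + x)
  R_gt : |mean f| + 1 + Δ⁻¹ < R
  C_pos : 0 < C
  c_pos : 0 < c
  bulk_lower : ∀ n : ℕ, 1 ≤ n → ∀ z ∈ Icc (-(2 * R)) (2 * R),
    C / √(n : ℝ) * Real.exp (-(c * n)) ≤ sumDensity f n (n * z)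
  upper : ∀ n : ℕ, 1 ≤ n →
    (∫ x, Real.exp (lam * |x|) * f x) ^ n *
        (4 * (n : ℝ) ^ (3 / 2 : ℝ) / Δ + L * C⁻¹ * √(n : ℝ) * Real.exp (c * n)) ≤
      CHat * Real.exp (cHat * n)

end RWBridge

end

/-!
If the steps are bounded on one side, say `X_i ≥ -c`, then on the bridge `S_k ≥ -n c`, and
`S_k ≤ z + n c` because the remaining steps have to lead back to `z`. So `|S_k| ≤ n c + |z|` almost
surely, and `2 |z| ≤ n + z ^ 2 / n` gives the bound
(`IsProbDensity.bridgeExpMax_le_of_bounded_side`).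

In the strongly unimodal case it suffices, by Jensen's inequality, to bound the exponential moment
with the full exponent `lam` by `exp (lam |z|)` times the left side of `UnimodalConstants.upper`.
For `|z| ≤ 2 R n` one inserts `|S_k| ≤ |z| + ∑ |X_i|` and `f ≤ L`, and divides by the lower bound of
`f_n(z)`. For the other endpoints, say `z > 2 R n`, the quantity `max |S_k| - z` is at most the
largest of the negative parts of `S_k` and `z - S_k`, and the exponential of the maximum is at most
the sum of the exponentials. For an antitone `φ` the conditional expectation `E[φ(S_k) | S_n = z]`
is nonincreasing in `z` when the density of `S_n - S_k` is log-concave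
(`lintegral_mul_lintegral_le`). Hence it is at most its average over the endpoints within distance
`1` of `n μ`, which is at most `E[φ(S_k)] √n / (2 Δ)`
(`IsProbDensity.lintegral_mul_sumDensity_le`). By reversal of the walk the same holds for
`φ(z - S_k)`.

Log-concavity of the densities `f_j` comes from Ibragimov's theorem
(`StronglyUnimodal.logConcave`). Convolving `f`, with distribution function `F`, with suitable
unimodal densities shows in the limit that `F(y) - r F(y - a)` is quasi-concave for all `r ≥ 0` and
`a > 0`. So its derivative `f(y) - r f(y - a)` cannot change sign from minus to plus, which means
that `f(y) / f(y - a)` is nonincreasing in `y`. Strong unimodality passes to all `f_j`, because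
convolution is associative.

For the existence of the constants, the central limit theorem gives `S_n` a probability bounded
below in `n μ + √n (1, 2)` and in `n μ + √n (-2, -1)`. So `f_n` is of order `n^{-1/2}` somewhere in
both intervals, and in between because it is unimodal (`StronglyUnimodal.exists_center_lower`). The
exponential lower bound of `f_n` follows by keeping every step in a compact interval
(`IsProbDensity.pow_le_sumDensity`).
-/

namespace RWBridge

/-- The probability measure on `ℝ` with density `f`, i.e. the law of one step of the walk. -/
noncomputable def stepLaw (f : ℝ → ℝ) : Measure ℝ :=
  volume.withDensity fun x => ENNReal.ofReal (f x)

/-- The law of `S_n = X_1 + ⋯ + X_n` as an iterated convolution of measures. Unlike `sumDensity` it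
is meaningful for `n = 0`, where it is the Dirac mass at `0`. -/
noncomputable def walkLaw (f : ℝ → ℝ) : ℕ → Measure ℝ
  | 0 => Measure.dirac 0
  | n + 1 => (stepLaw f).conv (walkLaw f n)

/-! ### Densities and their convolutions -/

namespace IsProbDensity

variable {f g h : ℝ → ℝ} {L : ℝ}

theorem measurable_ofReal (hf : IsProbDensity f) : Measurable fun x => ENNReal.ofReal (f x) :=
  hf.measurable.ennreal_ofReal

theorem measurable_ofReal_sub (hf : IsProbDensity f) (x : ℝ) :
    Measurable fun t => ENNReal.ofReal (f (x - t)) :=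
  hf.measurable_ofReal.comp (measurable_const_sub x)

theorem isProbabilityMeasure (hf : IsProbDensity f) : IsProbabilityMeasure (stepLaw f) :=
  ⟨by rw [stepLaw, withDensity_apply _ MeasurableSet.univ, Measure.restrict_univ,
    hf.lintegral_eq_one]⟩

theorem isProbabilityMeasure_walkLaw (hf : IsProbDensity f) :
    ∀ n, IsProbabilityMeasure (walkLaw f n)
  | 0 => by rw [walkLaw]; infer_instance
  | n + 1 => by
    have := hf.isProbabilityMeasure
    have := hf.isProbabilityMeasure_walkLaw n
    rw [walkLaw]; infer_instance

theorem integrable (hf : IsProbDensity f) : Integrable f := by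
  refine ⟨hf.measurable.aestronglyMeasurable, ?_⟩
  rw [hasFiniteIntegral_iff_ofReal (Eventually.of_forall hf.nonneg), hf.lintegral_eq_one]
  exact ENNReal.one_lt_top

theorem integral_eq_one (hf : IsProbDensity f) : ∫ x, f x = 1 := by
  rw [integral_eq_lintegral_of_nonneg_ae (Eventually.of_forall hf.nonneg)
    hf.measurable.aestronglyMeasurable, hf.lintegral_eq_one, ENNReal.toReal_one]

theorem lintegral_stepLaw (hf : IsProbDensity f) {u : ℝ → ENNReal} (hu : Measurable u) :
    ∫⁻ x, u x ∂stepLaw f = ∫⁻ x, ENNReal.ofReal (f x) * u x := by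
  rw [stepLaw, lintegral_withDensity_eq_lintegral_mul _ hf.measurable_ofReal hu]
  rfl

theorem integrable_conv_integrand (hf : IsProbDensity f) (hg : Measurable g) (h0 : ∀ x, 0 ≤ g x)
    (hL : ∀ x, g x ≤ L) (x : ℝ) : Integrable fun t => f t * g (x - t) := by
  refine hf.integrable.mul_bdd (c := L)
    (hg.comp (measurable_const_sub x)).aestronglyMeasurable (Eventually.of_forall fun t => ?_)
  rw [Real.norm_of_nonneg (h0 _)]
  exact hL _

theorem conv_nonneg (hf : IsProbDensity f) (h0 : ∀ x, 0 ≤ g x) (x : ℝ) : 0 ≤ conv f g x :=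
  integral_nonneg fun t => mul_nonneg (hf.nonneg t) (h0 _)

theorem conv_le (hf : IsProbDensity f) (hg : Measurable g) (h0 : ∀ x, 0 ≤ g x)
    (hL : ∀ x, g x ≤ L) (x : ℝ) : conv f g x ≤ L := by
  calc conv f g x ≤ ∫ t, f t * L :=
        integral_mono (hf.integrable_conv_integrand hg h0 hL x) (hf.integrable.mul_const L)
          fun t => mul_le_mul_of_nonneg_left (hL _) (hf.nonneg t)
    _ = L := by rw [integral_mul_const, hf.integral_eq_one, one_mul]

theorem ofReal_conv (hf : IsProbDensity f) (hg : Measurable g) (h0 : ∀ x, 0 ≤ g x)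
    (hL : ∀ x, g x ≤ L) (x : ℝ) :
    ENNReal.ofReal (conv f g x) = ∫⁻ t, ENNReal.ofReal (g (x - t)) ∂stepLaw f := by
  rw [hf.lintegral_stepLaw (by fun_prop)]
  change ENNReal.ofReal (∫ t, f t * g (x - t)) = _
  rw [ofReal_integral_eq_lintegral_ofReal (hf.integrable_conv_integrand hg h0 hL x)
    (Eventually.of_forall fun t => mul_nonneg (hf.nonneg t) (h0 _))]
  simp_rw [ENNReal.ofReal_mul (hf.nonneg _)]

theorem measurable_conv (hf : IsProbDensity f) (hg : Measurable g) : Measurable (conv f g) := by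
  have hf' := hf.measurable
  have : StronglyMeasurable fun p : ℝ × ℝ => f p.2 * g (p.1 - p.2) :=
    Measurable.stronglyMeasurable (by fun_prop)
  exact this.integral_prod_right.measurable

theorem stepLaw_conv (hf : IsProbDensity f) (hg : IsProbDensity g) (hL : ∀ x, g x ≤ L) :
    stepLaw (conv f g) = (stepLaw f).conv (stepLaw g) := by
  rw [stepLaw, stepLaw, stepLaw, conv_withDensity_eq_lconvolution hf.measurable_ofReal
    hg.measurable_ofReal]
  congr 1
  ext x
  rw [hf.ofReal_conv hg.measurable hg.nonneg hL,
    hf.lintegral_stepLaw (hg.measurable_ofReal_sub x), lconvolution_def]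
  simp_rw [sub_eq_neg_add]

theorem isProbDensity_conv (hf : IsProbDensity f) (hg : IsProbDensity g) (hL : ∀ x, g x ≤ L) :
    IsProbDensity (conv f g) := by
  refine ⟨hf.measurable_conv hg.measurable, hf.conv_nonneg hg.nonneg, ?_⟩
  have := hf.isProbabilityMeasure
  have := hg.isProbabilityMeasure
  have h := measure_univ (μ := (stepLaw f).conv (stepLaw g))
  rwa [← hf.stepLaw_conv hg hL, stepLaw, withDensity_apply _ MeasurableSet.univ,
    Measure.restrict_univ] at h

theorem conv_assoc {L' : ℝ} (hf : IsProbDensity f) (hg : IsProbDensity g) (hh : IsProbDensity h)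
    (hL : ∀ x, g x ≤ L) (hL' : ∀ x, h x ≤ L') :
    conv (conv f g) h = conv f (conv g h) := by
  have := hg.isProbabilityMeasure
  have hgh := hg.isProbDensity_conv hh hL'
  ext x
  rw [← ENNReal.ofReal_eq_ofReal_iff ((hf.isProbDensity_conv hg hL).conv_nonneg hh.nonneg x)
    (hf.conv_nonneg hgh.nonneg x),
    (hf.isProbDensity_conv hg hL).ofReal_conv hh.measurable hh.nonneg hL',
    hf.ofReal_conv hgh.measurable hgh.nonneg (hg.conv_le hh.measurable hh.nonneg hL'),
    hf.stepLaw_conv hg hL,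
    Measure.lintegral_conv (hh.measurable_ofReal_sub x)]
  refine lintegral_congr fun t => ?_
  rw [hg.ofReal_conv hh.measurable hh.nonneg hL']
  simp_rw [sub_sub]

theorem continuous_conv (hf : IsProbDensity f) (hg : Continuous g) (h0 : ∀ x, 0 ≤ g x)
    (hL : ∀ x, g x ≤ L) : Continuous (conv f g) := by
  refine BddAbove.continuous_convolution_right_of_integrable _ ⟨L, ?_⟩ hf.integrable hg
  rintro _ ⟨x, rfl⟩
  simpa [abs_of_nonneg (h0 x)] using hL x

/-- The densities `f_n` are probability densities, bounded by any bound of `f`. -/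
theorem isProbDensity_sumDensity (hf : IsProbDensity f) (hL : ∀ x, f x ≤ L) (n : ℕ) :
    IsProbDensity (sumDensity f (n + 1)) ∧ ∀ x, sumDensity f (n + 1) x ≤ L := by
  induction n with
  | zero => exact ⟨hf, hL⟩
  | succ n ih =>
    exact ⟨hf.isProbDensity_conv ih.1 ih.2, hf.conv_le ih.1.measurable ih.1.nonneg ih.2⟩

theorem continuous_sumDensity (hf : IsProbDensity f) (hc : Continuous f) (hL : ∀ x, f x ≤ L)
    (n : ℕ) : Continuous (sumDensity f (n + 1)) := by
  induction n with
  | zero => exact hc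
  | succ n ih =>
    exact hf.continuous_conv ih (hf.isProbDensity_sumDensity hL n).1.nonneg
      (hf.isProbDensity_sumDensity hL n).2

theorem walkLaw_succ (hf : IsProbDensity f) (hL : ∀ x, f x ≤ L) (n : ℕ) :
    walkLaw f (n + 1) = stepLaw (sumDensity f (n + 1)) := by
  have := hf.isProbabilityMeasure
  induction n with
  | zero => rw [walkLaw, walkLaw, Measure.conv_dirac_zero]; rfl
  | succ n ih =>
    rw [walkLaw, ih]
    exact (hf.stepLaw_conv (hf.isProbDensity_sumDensity hL n).1
      (hf.isProbDensity_sumDensity hL n).2).symm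

theorem lintegral_sub_walkLaw (hf : IsProbDensity f) (hL : ∀ x, f x ≤ L) (n : ℕ) (y : ℝ) :
    ∫⁻ t, ENNReal.ofReal (f (y - t)) ∂walkLaw f n
      = ENNReal.ofReal (sumDensity f (n + 1) y) := by
  induction n generalizing y with
  | zero =>
    rw [walkLaw, lintegral_dirac' _ (hf.measurable_ofReal_sub y), sub_zero]
    rfl
  | succ n ih =>
    have := hf.isProbabilityMeasure_walkLaw n
    have hn := hf.isProbDensity_sumDensity hL n
    change _ = ENNReal.ofReal (conv f (sumDensity f (n + 1)) y)
    rw [hf.ofReal_conv hn.1.measurable hn.1.nonneg hn.2, walkLaw,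
      Measure.lintegral_conv (hf.measurable_ofReal_sub y)]
    refine lintegral_congr fun t => ?_
    rw [← ih]
    simp_rw [sub_sub]

end IsProbDensity

/-! ### Integrals over the steps of the walk -/

theorem measurable_fin_cons {m : ℕ} :
    Measurable fun p : ℝ × (Fin m → ℝ) => (Fin.cons p.1 p.2 : Fin (m + 1) → ℝ) := by
  refine measurable_pi_lambda _ fun i => Fin.cases measurable_fst (fun j => ?_) i
  exact (measurable_pi_apply j).comp measurable_snd

theorem lintegral_pi_cons (μ : Measure ℝ) [SigmaFinite μ] {m : ℕ}
    {G : (Fin (m + 1) → ℝ) → ENNReal} (hG : Measurable G) :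
    ∫⁻ x, G x ∂Measure.pi (fun _ => μ)
      = ∫⁻ a, ∫⁻ x, G (Fin.cons a x) ∂Measure.pi (fun _ => μ) ∂μ := by
  have h := (measurePreserving_piFinSuccAbove (fun _ : Fin (m + 1) => μ) 0).symm
  rw [← h.lintegral_comp hG, ← lintegral_prod (μ := μ) (ν := Measure.pi fun _ : Fin m => μ)
      (fun p => G (Fin.cons p.1 p.2)) (hG.comp measurable_fin_cons).aemeasurable]
  simp only [MeasurableEquiv.piFinSuccAbove_symm_apply, Fin.insertNthEquiv_zero]
  rfl

theorem lintegral_pi_prod (μ : Measure ℝ) [SigmaFinite μ] {u : ℝ → ENNReal} (hu : Measurable u)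
    (m : ℕ) : ∫⁻ x : Fin m → ℝ, ∏ i, u (x i) ∂Measure.pi (fun _ => μ) = (∫⁻ t, u t ∂μ) ^ m := by
  induction m with
  | zero => simp
  | succ m ih =>
    rw [lintegral_pi_cons μ (by fun_prop)]
    simp only [Fin.prod_univ_succ, Fin.cons_zero, Fin.cons_succ]
    have : ∀ a, ∫⁻ x : Fin m → ℝ, u a * ∏ i, u (x i) ∂Measure.pi (fun _ => μ)
        = u a * (∫⁻ t, u t ∂μ) ^ m := fun a => by
      rw [lintegral_const_mul _ (by fun_prop), ih]
    simp_rw [this]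
    rw [lintegral_mul_const _ hu, pow_succ']

theorem IsProbDensity.lintegral_pi_stepLaw {f : ℝ → ℝ} (hf : IsProbDensity f) {m : ℕ}
    {G : (Fin m → ℝ) → ENNReal} (hG : Measurable G) :
    ∫⁻ x, G x ∂Measure.pi (fun _ => stepLaw f) = ∫⁻ x, (∏ i, ENNReal.ofReal (f (x i))) * G x := by
  have := hf.isProbabilityMeasure
  have hm := hf.measurable_ofReal
  induction m with
  | zero =>
    rw [volume_pi, Measure.pi_of_empty _ 0, Measure.pi_of_empty _ 0]
    simp
  | succ m ih =>
    rw [lintegral_pi_cons _ hG, volume_pi,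
      lintegral_pi_cons volume (by have := hf.measurable; fun_prop),
      hf.lintegral_stepLaw]
    · refine lintegral_congr fun a => ?_
      have ha : Measurable fun x : Fin m → ℝ => G (Fin.cons a x) :=
        hG.comp (measurable_fin_cons.comp measurable_prodMk_left)
      rw [ih ha, ← lintegral_const_mul _ (by have := hf.measurable; fun_prop)]
      simp [Fin.prod_univ_succ, mul_assoc, volume_pi]
    · exact (hG.comp measurable_fin_cons).lintegral_prod_right'
        (ν := Measure.pi fun _ : Fin m => stepLaw f)

/-- The joint law of `(S_k, S_m)` for `m = k + j`: the increment `S_m - S_k` is independent of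
`S_k` and distributed as `S_j`. -/
theorem IsProbDensity.lintegral_partial_sums {f : ℝ → ℝ} (hf : IsProbDensity f)
    {H : ℝ → ℝ → ENNReal} (hH : Measurable fun p : ℝ × ℝ => H p.1 p.2) (k j m : ℕ)
    (hm : m = k + j) :
    ∫⁻ x : Fin m → ℝ, H (∑ i : Fin m with i.val < k, x i) (∑ i, x i)
        ∂Measure.pi (fun _ => stepLaw f)
      = ∫⁻ s, ∫⁻ t, H s (s + t) ∂walkLaw f j ∂walkLaw f k := by
  have := hf.isProbabilityMeasure
  have hw := hf.isProbabilityMeasure_walkLaw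
  have hsum : ∀ {m : ℕ} (k : ℕ), Measurable fun x : Fin m → ℝ => ∑ i : Fin m with i.val < k, x i :=
    fun k => by fun_prop
  induction k generalizing j m H with
  | zero =>
    rw [walkLaw, lintegral_dirac]
    obtain rfl : m = j := by omega
    induction m generalizing H with
    | zero =>
      rw [walkLaw, lintegral_dirac]
      simp
    | succ m ih =>
      rw [lintegral_pi_cons _ (by fun_prop), walkLaw, Measure.lintegral_conv (by fun_prop)]
      refine lintegral_congr fun a => ?_
      have := ih (H := fun s t => H s (a + t)) (by fun_prop)
      simpa [Fin.sum_univ_succ] using this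
  | succ k ih =>
    obtain ⟨m, rfl⟩ : ∃ m', m = m' + 1 := ⟨k + j, by omega⟩
    rw [lintegral_pi_cons _ (by fun_prop), walkLaw, Measure.lintegral_conv (by
      exact Measurable.lintegral_prod_right'
        (f := fun p : ℝ × ℝ => H p.1 (p.1 + p.2)) (by fun_prop))]
    refine lintegral_congr fun a => ?_
    have := ih (H := fun s t => H (a + s) (a + t)) (by fun_prop) j m (by omega)
    simpa [Fin.sum_univ_succ, Finset.sum_filter, add_assoc] using this

/-- The law of the bridge is the law of the first `n - 1` steps of the free walk, reweighted by the
density of the last step. The junk value `0` of the density at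
`f_n(z) = 0` is excluded. -/
theorem IsProbDensity.lintegral_bridgeLaw {f : ℝ → ℝ} (hf : IsProbDensity f) {n : ℕ} {z : ℝ}
    (hz : 0 < sumDensity f n z) {G : (Fin (n - 1) → ℝ) → ENNReal} (hG : Measurable G) :
    ∫⁻ x, G x ∂bridgeLaw f n z
      = (∫⁻ x, G x * ENNReal.ofReal (f (z - ∑ i, x i)) ∂Measure.pi (fun _ => stepLaw f))
        / ENNReal.ofReal (sumDensity f n z) := by
  have hm := hf.measurable
  rw [hf.lintegral_pi_stepLaw (by fun_prop), bridgeLaw,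
    lintegral_withDensity_eq_lintegral_mul _ (by fun_prop) hG, ENNReal.div_eq_inv_mul,
    ← lintegral_const_mul _ (by fun_prop)]
  refine lintegral_congr fun x => ?_
  rw [Pi.mul_apply, ENNReal.ofReal_div_of_pos hz,
    ENNReal.ofReal_mul (Finset.prod_nonneg fun i _ => hf.nonneg _),
    ENNReal.ofReal_prod_of_nonneg fun i _ => hf.nonneg _, ENNReal.div_eq_inv_mul]
  ring

/-- The bridge law is a probability measure, unless `f_n(z) = 0`, when it is the zero measure
because of the convention `x / 0 = 0`. -/
theorem IsProbDensity.bridgeLaw_univ_le {f : ℝ → ℝ} {L : ℝ} (hf : IsProbDensity f)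
    (hL : ∀ x, f x ≤ L) {n : ℕ} (hn : 1 ≤ n) (z : ℝ) : bridgeLaw f n z univ ≤ 1 := by
  obtain ⟨m, rfl⟩ : ∃ m, n = m + 1 := ⟨n - 1, by omega⟩
  rcases ((hf.isProbDensity_sumDensity hL m).1.nonneg z).eq_or_lt with h | h
  · simp [bridgeLaw, ← h]
  · rw [← setLIntegral_one, Measure.restrict_univ,
      hf.lintegral_bridgeLaw h measurable_const]
    have hm := hf.measurable
    have h0 := hf.lintegral_partial_sums (H := fun _ w => ENNReal.ofReal (f (z - w)))
      (by fun_prop) 0 m m (by omega)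
    have h1 := hf.lintegral_sub_walkLaw hL m z
    simp only [one_mul]
    rw [walkLaw, lintegral_dirac] at h0
    simp only [zero_add] at h0
    change (∫⁻ x : Fin m → ℝ, ENNReal.ofReal (f (z - ∑ i, x i))
      ∂Measure.pi fun _ => stepLaw f) / _ ≤ 1
    rw [h0, h1]
    exact ENNReal.div_self_le_one

/-! ### Steps bounded on one side -/

theorem abs_walkPos_le_of_neg_le {n : ℕ} (hn : 1 ≤ n) {z c : ℝ} (hc : 0 ≤ c) {x : Fin (n - 1) → ℝ}
    (hx : ∀ i, -c ≤ x i) (hz : -c ≤ z - ∑ i, x i) (k : ℕ) :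
    |walkPos n z x k| ≤ n * c + |z| := by
  have hnc : 0 ≤ n * c := by positivity
  have hcast : ((n - 1 : ℕ) : ℝ) = n - 1 := by push_cast [hn]; ring
  have hsum : ∀ s : Finset (Fin (n - 1)), -((n - 1) * c) ≤ ∑ i ∈ s, x i := fun s => by
    have h1 : (s.card : ℝ) ≤ n - 1 := by
      rw [← hcast]; exact_mod_cast s.card_le_univ.trans_eq (Fintype.card_fin _)
    have h2 := Finset.card_nsmul_le_sum s x (-c) fun i _ => hx i
    rw [nsmul_eq_mul] at h2
    nlinarith
  unfold walkPos
  split_ifs with hk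
  · have hsplit := Finset.sum_filter_add_sum_filter_not Finset.univ
      (fun i : Fin (n - 1) => i.val < k) x
    have h1 := hsum {i : Fin (n - 1) | i.val < k}
    have h2 := hsum {i : Fin (n - 1) | ¬ i.val < k}
    rw [abs_le]
    constructor
    · linarith [abs_nonneg z]
    · linarith [le_abs_self z]
  · linarith

theorem walkPos_neg (n : ℕ) (z : ℝ) (x : Fin (n - 1) → ℝ) (k : ℕ) :
    walkPos n (-z) (-x) k = -walkPos n z x k := by
  unfold walkPos
  split_ifs <;> simp

theorem abs_walkPos_le_of_le {n : ℕ} (hn : 1 ≤ n) {z c : ℝ} (hc : 0 ≤ c) {x : Fin (n - 1) → ℝ}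
    (hx : ∀ i, x i ≤ c) (hz : z - ∑ i, x i ≤ c) (k : ℕ) :
    |walkPos n z x k| ≤ n * c + |z| := by
  have h := abs_walkPos_le_of_neg_le hn (z := -z) (x := -x) hc (fun i => neg_le_neg (hx i))
    (by simp only [Pi.neg_apply, Finset.sum_neg_distrib]; linarith) k
  rwa [walkPos_neg, abs_neg, abs_neg] at h

theorem two_mul_abs_le {n : ℕ} (hn : 1 ≤ n) (z : ℝ) : 2 * |z| ≤ n + z ^ 2 / n := by
  have hn' : (0 : ℝ) < n := by exact_mod_cast hn
  rw [← sub_nonneg]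
  have : (n : ℝ) + z ^ 2 / n - 2 * |z| = (n - |z|) ^ 2 / n := by
    rw [← sq_abs z]; field_simp; ring
  rw [this]
  positivity

/-- On the support of the bridge law every step, the last one included, lies in the support of
`f`. -/
theorem IsProbDensity.ae_bridgeLaw {f : ℝ → ℝ} (hf : IsProbDensity f) (n : ℕ) (z : ℝ) :
    ∀ᵐ x ∂bridgeLaw f n z, (∀ i, f (x i) ≠ 0) ∧ f (z - ∑ i, x i) ≠ 0 := by
  have hm := hf.measurable
  rw [bridgeLaw, ae_withDensity_iff (by fun_prop)]
  refine Eventually.of_forall fun x hx => ⟨fun i hi => hx ?_, fun h => hx ?_⟩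
  · rw [Finset.prod_eq_zero (Finset.mem_univ i) hi]; simp
  · rw [h]; simp

/-- If the steps are bounded by `c` on one side, then `|S_k| ≤ n c + |z|` on the bridge, because a
partial sum that is too large cannot be brought back to `z` by the remaining steps. -/
theorem IsProbDensity.bridgeExpMax_le_of_bounded_side {f : ℝ → ℝ} {L c : ℝ} (hf : IsProbDensity f)
    (hL : ∀ x, f x ≤ L) (hc0 : 0 ≤ c)
    (hc : (∀ y, f y ≠ 0 → -c ≤ y) ∨ (∀ y, f y ≠ 0 → y ≤ c)) {n : ℕ} (hn : 1 ≤ n) (z : ℝ) {b : ℝ}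
    (hb : 0 < b) :
    bridgeExpMax f n z (b / (1 + b + c)) ≤ ENNReal.ofReal (1 * Real.exp (b * (n + z ^ 2 / n))) := by
  have : Nonempty (Fin n) := ⟨⟨0, hn⟩⟩
  have hn0 : (0 : ℝ) < n := by exact_mod_cast hn
  have ha : 0 ≤ b / (1 + b + c) := by positivity
  calc bridgeExpMax f n z (b / (1 + b + c))
      ≤ ∫⁻ _, ENNReal.ofReal (1 * Real.exp (b * (n + z ^ 2 / n))) ∂bridgeLaw f n z := by
        refine lintegral_mono_ae ?_
        filter_upwards [hf.ae_bridgeLaw n z] with x hx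
        rw [one_mul]
        refine ENNReal.ofReal_le_ofReal (Real.exp_le_exp.2 ?_)
        have hmax : ⨆ k : Fin n, |walkPos n z x (k.val + 1)| ≤ n * c + |z| := by
          refine ciSup_le fun k => ?_
          rcases hc with hc | hc
          · exact abs_walkPos_le_of_neg_le hn hc0 (fun i => hc _ (hx.1 i)) (hc _ hx.2) _
          · exact abs_walkPos_le_of_le hn hc0 (fun i => hc _ (hx.1 i)) (hc _ hx.2) _
        have hT : n * c + |z| ≤ (1 + b + c) * (n + z ^ 2 / n) := by
          have h0 : 0 ≤ z ^ 2 / n := by positivity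
          have h1 := two_mul_abs_le hn z
          nlinarith [mul_nonneg hb.le h0, mul_nonneg hc0 h0]
        calc b / (1 + b + c) * (⨆ k : Fin n, |walkPos n z x (k.val + 1)|)
            ≤ b / (1 + b + c) * ((1 + b + c) * (n + z ^ 2 / n)) :=
              mul_le_mul_of_nonneg_left (hmax.trans hT) ha
          _ = b * (n + z ^ 2 / n) := by field_simp
    _ ≤ ENNReal.ofReal (1 * Real.exp (b * (n + z ^ 2 / n))) := by
        rw [lintegral_const]
        exact mul_le_of_le_one_right' (hf.bridgeLaw_univ_le hL hn z)

/-! ### Strong unimodality and log-concavity -/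

/-- The weak form of unimodality that is stable under pointwise limits: `g` is at least the smaller
of its values at the ends of any interval. -/
def QuasiConcave (g : ℝ → ℝ) : Prop := ∀ ⦃x y z⦄, x ≤ y → y ≤ z → min (g x) (g z) ≤ g y

theorem Unimodal.quasiConcave {g : ℝ → ℝ} (hg : Unimodal g) : QuasiConcave g := by
  obtain ⟨M, h1, h2⟩ := hg
  intro x y z hxy hyz
  rcases le_total y M with h | h
  · exact (min_le_left _ _).trans (h1 (hxy.trans h) h hxy)
  · exact (min_le_right _ _).trans (h2 h (h.trans hyz) hyz)

theorem QuasiConcave.of_tendsto {u : ℕ → ℝ → ℝ} {g : ℝ → ℝ} (hu : ∀ n, QuasiConcave (u n))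
    (hg : ∀ x, Tendsto (fun n => u n x) atTop (𝓝 (g x))) : QuasiConcave g := fun x y z hxy hyz =>
  le_of_tendsto_of_tendsto' ((hg x).min (hg z)) (hg y) fun n => hu n hxy hyz

/-- A differentiable quasi-concave function cannot first decrease and then increase strictly. -/
theorem QuasiConcave.deriv_nonneg_or {g : ℝ → ℝ} (hg : QuasiConcave g) {x x' d d' : ℝ}
    (hxx : x < x') (hd : HasDerivAt g d x) (hd' : HasDerivAt g d' x') : 0 ≤ d ∨ d' ≤ 0 := by
  by_contra! h
  obtain ⟨h1, h2⟩ := h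
  have e1 : ∀ᶠ y in 𝓝[>] x, g y < g x ∧ x < y ∧ y < x' := by
    have := (hasDerivWithinAt_iff_tendsto_slope' (s := Ioi x) (by simp)).1 hd.hasDerivWithinAt
    filter_upwards [this.eventually_lt_const h1, self_mem_nhdsWithin,
      nhdsWithin_le_nhds (Iio_mem_nhds hxx)] with y hy hy' hy''
    exact ⟨(slope_neg_iff_of_le (le_of_lt hy')).1 hy, hy', hy''⟩
  have e2 : ∀ᶠ y in 𝓝[<] x', g y < g x' ∧ x < y ∧ y < x' := by
    have := (hasDerivWithinAt_iff_tendsto_slope' (s := Iio x') (by simp)).1 hd'.hasDerivWithinAt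
    filter_upwards [this.eventually_const_lt h2, self_mem_nhdsWithin,
      nhdsWithin_le_nhds (Ioi_mem_nhds hxx)] with y hy hy' hy''
    rw [slope_comm] at hy
    exact ⟨(slope_pos_iff_of_le (le_of_lt hy')).1 hy, hy'', hy'⟩
  obtain ⟨y, hy, hxy, hy'⟩ := e1.exists
  obtain ⟨w, hw, hxw, hw'⟩ := e2.exists
  have h3 := hg hxw.le hw'.le
  have h4 := hg hxy.le hy'.le
  rw [min_le_iff] at h3 h4
  rcases h3 with h3 | h3 <;> rcases h4 with h4 | h4 <;> linarith

/-- The ramp that rises linearly from `0` to `1` on `[0, ε]`. -/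
noncomputable def ramp (ε x : ℝ) : ℝ := max 0 (min 1 (x / ε))

theorem ramp_mono {ε : ℝ} (hε : 0 < ε) : Monotone (ramp ε) := fun x y h => by
  unfold ramp; gcongr

theorem continuous_ramp (ε : ℝ) : Continuous (ramp ε) := by unfold ramp; fun_prop

theorem ramp_nonneg (ε x : ℝ) : 0 ≤ ramp ε x := le_max_left _ _

theorem ramp_le_one (ε x : ℝ) : ramp ε x ≤ 1 := max_le zero_le_one (min_le_left _ _)

theorem ramp_of_nonpos {ε x : ℝ} (hε : 0 < ε) (hx : x ≤ 0) : ramp ε x = 0 :=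
  max_eq_left ((min_le_right _ _).trans (div_nonpos_of_nonpos_of_nonneg hx hε.le))

theorem ramp_of_le {ε x : ℝ} (hε : 0 < ε) (hx : ε ≤ x) : ramp ε x = 1 := by
  rw [ramp, min_eq_left ((one_le_div hε).2 hx), max_eq_right zero_le_one]

/-- A continuous approximation of the unimodal step function
`p 1_{(-b, ∞)} + 1_{(0, ∞)} - r 1_{(a, ∞)} - q 1_{(b, ∞)}`. -/
noncomputable def bump (ε a b r p q x : ℝ) : ℝ :=
  p * ramp ε (x + b) + ramp ε x - r * ramp ε (x - a) - q * ramp ε (x - b)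

section Bump

variable {ε a b r p q : ℝ}

theorem continuous_bump : Continuous (bump ε a b r p q) := by
  have := continuous_ramp ε
  unfold bump; fun_prop

theorem bump_of_le (hε : 0 < ε) (hab : a ≤ b) {x : ℝ} (hx : x ≤ a) :
    bump ε a b r p q x = p * ramp ε (x + b) + ramp ε x := by
  rw [bump, ramp_of_nonpos hε (by linarith : x - a ≤ 0),
    ramp_of_nonpos hε (by linarith : x - b ≤ 0)]
  ring

theorem bump_of_ge (hε : 0 < ε) (hεa : ε ≤ a) (hab : a ≤ b) {x : ℝ} (hx : a ≤ x) :
    bump ε a b r p q x = p + 1 - r * ramp ε (x - a) - q * ramp ε (x - b) := by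
  rw [bump, ramp_of_le hε (by linarith : ε ≤ x + b), ramp_of_le hε (by linarith : ε ≤ x)]
  ring

theorem unimodal_bump (hε : 0 < ε) (hεa : ε ≤ a) (hab : a ≤ b) (hp : 0 ≤ p) (hq : 0 ≤ q)
    (hr : 0 ≤ r) : Unimodal (bump ε a b r p q) := by
  refine ⟨a, fun x hx y hy h => ?_, fun x hx y hy h => ?_⟩
  · rw [bump_of_le hε hab hx, bump_of_le hε hab hy]
    gcongr <;> exact ramp_mono hε (by linarith)
  · rw [bump_of_ge hε hεa hab hx, bump_of_ge hε hεa hab hy]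
    gcongr <;> exact ramp_mono hε (by linarith)

theorem bump_nonneg (hε : 0 < ε) (hεa : ε ≤ a) (hab : a ≤ b) (hp : 0 ≤ p) (hq : 0 ≤ q)
    (hr : 0 ≤ r) (hpq : p + 1 = r + q) (x : ℝ) : 0 ≤ bump ε a b r p q x := by
  rcases le_total x a with h | h
  · rw [bump_of_le hε hab h]
    have := ramp_nonneg ε (x + b)
    have := ramp_nonneg ε x
    positivity
  · rw [bump_of_ge hε hεa hab h, hpq]
    nlinarith [ramp_le_one ε (x - a), ramp_le_one ε (x - b)]

theorem bump_le (hp : 0 ≤ p) (hq : 0 ≤ q) (hr : 0 ≤ r) (x : ℝ) : bump ε a b r p q x ≤ p + 1 := by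
  have h1 := mul_nonneg hr (ramp_nonneg ε (x - a))
  have h2 := mul_nonneg hq (ramp_nonneg ε (x - b))
  have h3 := mul_le_of_le_one_right hp (ramp_le_one ε (x + b))
  have h4 := ramp_le_one ε x
  unfold bump; linarith

theorem hasCompactSupport_bump (hε : 0 < ε) (hεa : ε ≤ a) (hab : a ≤ b) (hpq : p + 1 = r + q) :
    HasCompactSupport (bump ε a b r p q) := by
  refine HasCompactSupport.intro (K := Icc (-b) (b + ε)) isCompact_Icc fun x hx => ?_
  rw [mem_Icc, not_and_or, not_le, not_le] at hx
  rcases hx with hx | hx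
  · rw [bump_of_le hε hab (by linarith), ramp_of_nonpos hε (by linarith),
      ramp_of_nonpos hε (by linarith)]
    ring
  · rw [bump_of_ge hε hεa hab (by linarith), ramp_of_le hε (by linarith),
      ramp_of_le hε (by linarith)]
    linarith

/-- `bump` is a positive multiple of a continuous unimodal density. -/
theorem StronglyUnimodal.quasiConcave_conv_bump {f : ℝ → ℝ} (hs : StronglyUnimodal f)
    (hε : 0 < ε) (hεa : ε ≤ a) (hab : a ≤ b) (hp : 0 ≤ p) (hq : 0 ≤ q)
    (hr : 0 ≤ r) (hpq : p + 1 = r + q) : QuasiConcave (conv f (bump ε a b r p q)) := by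
  have hc : Continuous (bump ε a b r p q) := continuous_bump
  have h0 := bump_nonneg hε hεa hab hp hq hr hpq
  have hcs := hasCompactSupport_bump hε hεa hab hpq
  set I := ∫ x, bump ε a b r p q x with hI
  have hIpos : 0 < I := by
    refine hc.integral_pos_of_hasCompactSupport_nonneg_nonzero hcs h0 (x := a) ?_
    rw [bump_of_le hε hab le_rfl, ramp_of_le hε (by linarith), ramp_of_le hε hεa]
    linarith
  have hd : IsProbDensity fun x => I⁻¹ * bump ε a b r p q x := by
    refine ⟨by have := hc.measurable; fun_prop, fun x => mul_nonneg (inv_nonneg.2 hIpos.le) (h0 x),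
      ?_⟩
    rw [← ofReal_integral_eq_lintegral_ofReal
      ((hc.integrable_of_hasCompactSupport hcs).const_mul _)
      (Eventually.of_forall fun x => mul_nonneg (inv_nonneg.2 hIpos.le) (h0 x)),
      integral_const_mul, ← hI, inv_mul_cancel₀ hIpos.ne', ENNReal.ofReal_one]
  obtain ⟨M, hM⟩ := unimodal_bump hε hεa hab hp hq hr
  have hi : 0 ≤ I⁻¹ := inv_nonneg.2 hIpos.le
  have hu := (hs _ hd (hc.const_mul _) ⟨M,
    fun x hx y hy h => mul_le_mul_of_nonneg_left (hM.1 hx hy h) hi,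
    fun x hx y hy h => mul_le_mul_of_nonneg_left (hM.2 hx hy h) hi⟩).quasiConcave
  have he : ∀ x, conv f (fun x => I⁻¹ * bump ε a b r p q x) x
      = I⁻¹ * conv f (bump ε a b r p q) x := fun x => by
    change ∫ t, f t * (I⁻¹ * bump ε a b r p q (x - t)) = I⁻¹ * ∫ t, f t * bump ε a b r p q (x - t)
    rw [← integral_const_mul]
    congr 1; ext t; ring
  intro x y z hxy hyz
  have h := hu hxy hyz
  rw [he, he, he, ← mul_min_of_nonneg _ _ hi] at h
  exact le_of_mul_le_mul_left h (inv_pos.2 hIpos)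

end Bump

theorem tendsto_ramp {ε : ℕ → ℝ} (hε : ∀ n, 0 < ε n) (hlim : Tendsto ε atTop (𝓝 0)) (x : ℝ) :
    Tendsto (fun n => ramp (ε n) x) atTop (𝓝 ((Ioi 0).indicator 1 x)) := by
  by_cases hx : 0 < x
  · rw [indicator_of_mem (mem_Ioi.2 hx)]
    refine tendsto_const_nhds.congr' ?_
    filter_upwards [hlim.eventually_lt_const hx] with n hn
    rw [ramp_of_le (hε n) hn.le, Pi.one_apply]
  · rw [indicator_of_notMem (notMem_Ioi.2 (not_lt.1 hx))]
    refine tendsto_const_nhds.congr' (Eventually.of_forall fun n => ?_)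
    exact (ramp_of_nonpos (hε n) (not_lt.1 hx)).symm

/-- Take the limit of `conv f (bump ..)` as the ramps become steep and the outer steps move to `±∞`.
The step at `-b` then only adds the constant `p`, and the step at `b` disappears. -/
theorem StronglyUnimodal.quasiConcave_cdf_sub {f : ℝ → ℝ} (hf : IsProbDensity f)
    (hs : StronglyUnimodal f) {r a : ℝ} (hr : 0 ≤ r) (ha : 0 < a) :
    QuasiConcave fun y => (∫ t in Iic y, f t) - r * ∫ t in Iic (y - a), f t := by
  set p := max (r - 1) 0 with hp
  set q := max (1 - r) 0 with hq
  have hp0 : 0 ≤ p := le_max_right _ _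
  have hq0 : 0 ≤ q := le_max_right _ _
  have hpq : p + 1 = r + q := by
    rcases le_total r 1 with h | h
    · rw [hp, hq, max_eq_right (by linarith), max_eq_left (by linarith)]; ring
    · rw [hp, hq, max_eq_left (by linarith), max_eq_right (by linarith)]; ring
  set ε : ℕ → ℝ := fun n => a / (n + 1) with hε
  set b : ℕ → ℝ := fun n => a + n with hb
  have hε0 : ∀ n, 0 < ε n := fun n => by positivity
  have hεa : ∀ n, ε n ≤ a := fun n => div_le_self ha.le (by simp)
  have hab : ∀ n, a ≤ b n := fun n => by simp [hb]
  have hεlim : Tendsto ε atTop (𝓝 0) := by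
    simpa [hε, div_eq_mul_inv] using (tendsto_one_div_add_atTop_nhds_zero_nat (𝕜 := ℝ)).const_mul a
  have hblim : Tendsto b atTop atTop := tendsto_atTop_add_const_left _ _ tendsto_natCast_atTop_atTop
  have key : QuasiConcave fun y => p + ((∫ t in Iic y, f t) - r * ∫ t in Iic (y - a), f t) := by
    refine QuasiConcave.of_tendsto
      (fun n => hs.quasiConcave_conv_bump (hε0 n) (hεa n) (hab n) hp0 hq0 hr hpq) fun y => ?_
    have hlim : p + ((∫ t in Iic y, f t) - r * ∫ t in Iic (y - a), f t)
        = ∫ t, f t * (p * 1 + (Ioi (0 : ℝ)).indicator 1 (y - t)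
            - r * (Ioi (0 : ℝ)).indicator 1 (y - t - a) - q * 0) := by
      have hi : ∀ c : ℝ, ∫ t in Iic c, f t = ∫ t, (Iio c).indicator f t := fun c => by
        rw [integral_Iic_eq_integral_Iio, integral_indicator measurableSet_Iio]
      have hj : ∀ c : ℝ, Integrable ((Iio c).indicator f) := fun c =>
        hf.integrable.indicator measurableSet_Iio
      have hsub : Integrable fun t => (Iio y).indicator f t - r * (Iio (y - a)).indicator f t :=
        (hj y).sub ((hj (y - a)).const_mul r)
      have hp' : p = ∫ t, p * f t := by rw [integral_const_mul, hf.integral_eq_one, mul_one]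
      rw [hi, hi, ← integral_const_mul, ← integral_sub (hj _) ((hj _).const_mul _)]
      nth_rw 1 [hp']
      rw [← integral_add (hf.integrable.const_mul _) hsub]
      congr 1; ext t
      have e1 : (Ioi (0 : ℝ)).indicator (1 : ℝ → ℝ) (y - t) * f t = (Iio y).indicator f t := by
        by_cases h : t < y <;> simp [h, indicator]
      have e2 : (Ioi (0 : ℝ)).indicator (1 : ℝ → ℝ) (y - t - a) * f t
          = (Iio (y - a)).indicator f t := by
        have : 0 < y - t - a ↔ t < y - a := by constructor <;> intro h <;> linarith
        by_cases h : t < y - a <;> simp [h, indicator, this]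
      rw [← e1, ← e2]; ring
    rw [hlim]
    refine tendsto_integral_of_dominated_convergence (fun t => (p + 1) * f t) (fun n => ?_)
      (hf.integrable.const_mul _) (fun n => Eventually.of_forall fun t => ?_)
      (Eventually.of_forall fun t => ?_)
    · have := hf.measurable
      have : Measurable (bump (ε n) a (b n) r p q) := continuous_bump.measurable
      exact Measurable.aestronglyMeasurable (f := fun t => f t * bump (ε n) a (b n) r p q (y - t))
        (by fun_prop)
    · change ‖f t * bump (ε n) a (b n) r p q (y - t)‖ ≤ _
      rw [Real.norm_of_nonneg (mul_nonneg (hf.nonneg t)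
        (bump_nonneg (hε0 n) (hεa n) (hab n) hp0 hq0 hr hpq _)), mul_comm]
      exact mul_le_mul_of_nonneg_right (bump_le hp0 hq0 hr _) (hf.nonneg t)
    · refine Tendsto.const_mul (f t) ?_
      refine (((Tendsto.const_mul p ?_).add (tendsto_ramp hε0 hεlim _)).sub
        ((tendsto_ramp hε0 hεlim _).const_mul r)).sub (Tendsto.const_mul q ?_)
      · refine tendsto_const_nhds.congr' ?_
        filter_upwards [hblim.eventually_ge_atTop (a - (y - t))] with n hn
        exact (ramp_of_le (hε0 n) (by linarith [hεa n])).symm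
      · refine tendsto_const_nhds.congr' ?_
        filter_upwards [hblim.eventually_ge_atTop (y - t)] with n hn
        exact (ramp_of_nonpos (hε0 n) (by linarith)).symm
  intro x y z hxy hyz
  have h := key hxy hyz
  simp only [min_add_add_left] at h
  exact (add_le_add_iff_left p).1 h

theorem IsProbDensity.hasDerivAt_cdf {f : ℝ → ℝ} (hf : IsProbDensity f) (hc : Continuous f)
    (y : ℝ) : HasDerivAt (fun y => ∫ t in Iic y, f t) (f y) y := by
  have h := (hc.integral_hasStrictDerivAt 0 y).hasDerivAt.add_const (∫ t in Iic (0 : ℝ), f t)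
  refine h.congr_of_eventuallyEq (Eventually.of_forall fun u => ?_)
  have := intervalIntegral.integral_Iic_sub_Iic (f := f) (μ := volume) (a := 0) (b := u)
    hf.integrable.integrableOn hf.integrable.integrableOn
  simp only [← this]; ring

/-- **Ibragimov's theorem**: a positive continuous strongly unimodal density is log-concave, i.e.
`f x / f (x - a)` is nonincreasing in `x` for every shift `a ≥ 0`. -/
theorem StronglyUnimodal.logConcave {f : ℝ → ℝ} (hf : IsProbDensity f) (hc : Continuous f)
    (hpos : ∀ x, 0 < f x) (hs : StronglyUnimodal f) {x x' a : ℝ} (hx : x ≤ x') (ha : 0 ≤ a) :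
    f x' * f (x - a) ≤ f x * f (x' - a) := by
  rcases hx.eq_or_lt with rfl | hx
  · exact le_rfl
  rcases ha.eq_or_lt with rfl | ha
  · simp [mul_comm]
  by_contra! h
  have hlt : f x / f (x - a) < f x' / f (x' - a) := by
    rwa [div_lt_div_iff₀ (hpos _) (hpos _)]
  -- A level `r` strictly between the two ratios makes the derivative of `F(y) - r F(y - a)`, where
  -- `F` is the distribution function of `f`, change its sign from minus to plus.
  obtain ⟨r, h1, h2⟩ := exists_between hlt
  have hr : 0 ≤ r := (div_pos (hpos _) (hpos _)).le.trans h1.le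
  have hd : ∀ y, HasDerivAt (fun y => (∫ t in Iic y, f t) - r * ∫ t in Iic (y - a), f t)
      (f y - r * f (y - a)) y := fun y =>
    (hf.hasDerivAt_cdf hc y).sub (((hf.hasDerivAt_cdf hc (y - a)).comp_sub_const y a).const_mul r)
  rw [div_lt_iff₀ (hpos _)] at h1
  rw [lt_div_iff₀ (hpos _)] at h2
  rcases (hs.quasiConcave_cdf_sub hf hr ha).deriv_nonneg_or hx (hd x) (hd x') with h | h <;>
    linarith

theorem stronglyUnimodal_conv {f g : ℝ → ℝ} {L : ℝ} (hf : IsProbDensity f) (hg : IsProbDensity g)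
    (hL : ∀ x, g x ≤ L) (hsf : StronglyUnimodal f) (hsg : StronglyUnimodal g) :
    StronglyUnimodal (conv f g) := by
  intro h hh hc hu
  obtain ⟨L', hL'⟩ : ∃ L', ∀ x, h x ≤ L' := by
    obtain ⟨M, h1, h2⟩ := hu
    exact ⟨h M, fun x => (le_total x M).elim (fun hx => h1 hx self_mem_Iic hx)
      fun hx => h2 self_mem_Ici hx hx⟩
  rw [hf.conv_assoc hg hh hL hL']
  exact hsf _ (hg.isProbDensity_conv hh hL') (hg.continuous_conv hc hh.nonneg hL') (hsg h hh hc hu)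

theorem stronglyUnimodal_sumDensity {f : ℝ → ℝ} {L : ℝ} (hf : IsProbDensity f)
    (hL : ∀ x, f x ≤ L) (hs : StronglyUnimodal f) (n : ℕ) :
    StronglyUnimodal (sumDensity f (n + 1)) := by
  induction n with
  | zero => exact hs
  | succ n ih =>
    exact stronglyUnimodal_conv hf (hf.isProbDensity_sumDensity hL n).1
      (hf.isProbDensity_sumDensity hL n).2 hs ih

/-! ### Monotonicity of conditional expectations given the endpoint -/

theorem ennreal_mul_add_mul_le {a b c d : ENNReal} (hab : a ≤ b) (hcd : c ≤ d) :
    a * d + b * c ≤ a * c + b * d := by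
  obtain ⟨e, rfl⟩ := exists_add_of_le hab
  obtain ⟨g, rfl⟩ := exists_add_of_le hcd
  calc a * (c + g) + (a + e) * c ≤ a * (c + g) + (a + e) * c + e * g := le_self_add
    _ = a * c + (a + e) * (c + g) := by ring

/-- If `q` is log-concave and `φ` is antitone, then `E[φ(S) | S + T = z]` is nonincreasing in `z`
when `S` has law `ρ` and `T` has density `q` (and nondecreasing if `φ` is monotone). The quotients
are multiplied out. The difference of the two sides is a double integral over `(s, s')` whose
integrand has a sign after symmetrization in `s` and `s'`. -/
theorem lintegral_mul_lintegral_le {ρ : Measure ℝ} [SFinite ρ] {φ : ℝ → ENNReal}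
    (hφ : Measurable φ) {q : ℝ → ℝ} (hqm : Measurable q) (hq0 : ∀ x, 0 ≤ q x)
    (hq : ∀ ⦃x x' a : ℝ⦄, x ≤ x' → 0 ≤ a → q x' * q (x - a) ≤ q x * q (x' - a)) {z z₀ : ℝ}
    (h : (Antitone φ ∧ z₀ ≤ z) ∨ (Monotone φ ∧ z ≤ z₀)) :
    (∫⁻ s, φ s * ENNReal.ofReal (q (z - s)) ∂ρ) * ∫⁻ s, ENNReal.ofReal (q (z₀ - s)) ∂ρ
      ≤ (∫⁻ s, φ s * ENNReal.ofReal (q (z₀ - s)) ∂ρ) * ∫⁻ s, ENNReal.ofReal (q (z - s)) ∂ρ := by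
  set A : ℝ → ℝ → ENNReal := fun s s' => ENNReal.ofReal (q (z - s)) * ENNReal.ofReal (q (z₀ - s'))
    with hA
  have hAm : Measurable fun p : ℝ × ℝ => A p.1 p.2 := by fun_prop
  have hAm' : Measurable fun p : ℝ × ℝ => A p.2 p.1 := by fun_prop
  have e1 : (∫⁻ s, φ s * ENNReal.ofReal (q (z - s)) ∂ρ) * ∫⁻ s, ENNReal.ofReal (q (z₀ - s)) ∂ρ
      = ∫⁻ s, ∫⁻ s', φ s * A s s' ∂ρ ∂ρ := by
    rw [lintegral_mul_const _ (by fun_prop) |>.symm]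
    refine lintegral_congr fun s => ?_
    rw [← lintegral_const_mul _ (by fun_prop)]
    simp_rw [hA, mul_assoc]
  have e2 : (∫⁻ s, φ s * ENNReal.ofReal (q (z₀ - s)) ∂ρ) * ∫⁻ s, ENNReal.ofReal (q (z - s)) ∂ρ
      = ∫⁻ s, ∫⁻ s', φ s * A s' s ∂ρ ∂ρ := by
    rw [lintegral_mul_const _ (by fun_prop) |>.symm]
    refine lintegral_congr fun s => ?_
    rw [← lintegral_const_mul _ (by fun_prop)]
    refine lintegral_congr fun s' => ?_
    simp only [hA]; ring
  have e1' : ∫⁻ s, ∫⁻ s', φ s * A s s' ∂ρ ∂ρ = ∫⁻ s, ∫⁻ s', φ s' * A s' s ∂ρ ∂ρ :=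
    lintegral_lintegral_swap (by fun_prop)
  have e2' : ∫⁻ s, ∫⁻ s', φ s * A s' s ∂ρ ∂ρ = ∫⁻ s, ∫⁻ s', φ s' * A s s' ∂ρ ∂ρ :=
    lintegral_lintegral_swap (by fun_prop)
  have hpt : ∀ s s', s ≤ s' → φ s * A s s' + φ s' * A s' s ≤ φ s * A s' s + φ s' * A s s' := by
    intro s s' hs
    have hA_le : ∀ {u v u' v' : ℝ}, q u * q v ≤ q u' * q v' →
        ENNReal.ofReal (q u) * ENNReal.ofReal (q v)
          ≤ ENNReal.ofReal (q u') * ENNReal.ofReal (q v') := fun h => by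
      rw [← ENNReal.ofReal_mul (hq0 _), ← ENNReal.ofReal_mul (hq0 _)]
      exact ENNReal.ofReal_le_ofReal h
    rcases h with ⟨hφ, hz⟩ | ⟨hφ, hz⟩
    · have h1 : A s s' ≤ A s' s := hA_le (by
        have := hq (x := z - s') (x' := z - s) (a := z - z₀) (by linarith) (by linarith)
        convert this using 3 <;> ring)
      have := ennreal_mul_add_mul_le (hφ hs) h1
      rw [add_comm, add_comm (φ s * A s' s)]
      exact this
    · have h1 : A s' s ≤ A s s' := hA_le (by
        have := hq (x := z₀ - s') (x' := z₀ - s) (a := z₀ - z) (by linarith) (by linarith)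
        rw [mul_comm, mul_comm (q (z - s))]
        convert this using 3 <;> ring)
      exact ennreal_mul_add_mul_le (hφ hs) h1
  have hsum : ∫⁻ s, ∫⁻ s', (φ s * A s s' + φ s' * A s' s) ∂ρ ∂ρ
      ≤ ∫⁻ s, ∫⁻ s', (φ s * A s' s + φ s' * A s s') ∂ρ ∂ρ := by
    refine lintegral_mono fun s => lintegral_mono fun s' => ?_
    rcases le_total s s' with hs | hs
    · exact hpt s s' hs
    · have := hpt s' s hs
      rwa [add_comm (φ s' * A s' s), add_comm (φ s' * A s s')] at this
  have hadd : ∀ u w : ℝ × ℝ → ENNReal, Measurable u → Measurable w →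
      ∫⁻ s, ∫⁻ s', (u (s, s') + w (s, s')) ∂ρ ∂ρ
        = (∫⁻ s, ∫⁻ s', u (s, s') ∂ρ ∂ρ) + ∫⁻ s, ∫⁻ s', w (s, s') ∂ρ ∂ρ := fun u w hu hw => by
    rw [← lintegral_add_left hu.lintegral_prod_right']
    exact lintegral_congr fun s => lintegral_add_left (hu.comp measurable_prodMk_left) _
  rw [hadd (fun p => φ p.1 * A p.1 p.2) (fun p => φ p.2 * A p.2 p.1) (by fun_prop) (by fun_prop),
    hadd (fun p => φ p.1 * A p.2 p.1) (fun p => φ p.2 * A p.1 p.2) (by fun_prop) (by fun_prop),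
    ← e1', ← e2', ← two_mul, ← two_mul] at hsum
  rw [e1, e2]
  exact (ENNReal.mul_le_mul_iff_right two_ne_zero ENNReal.ofNat_ne_top).1 hsum

theorem IsProbDensity.lintegral_sumDensity_sub_walkLaw {f : ℝ → ℝ} {L : ℝ} (hf : IsProbDensity f)
    (hL : ∀ x, f x ≤ L) (k j : ℕ) (z : ℝ) :
    ∫⁻ s, ENNReal.ofReal (sumDensity f (j + 1) (z - s)) ∂walkLaw f k
      = ENNReal.ofReal (sumDensity f (k + j + 1) z) := by
  induction k generalizing z with
  | zero => rw [walkLaw, lintegral_dirac, sub_zero, zero_add]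
  | succ k ih =>
    have := hf.isProbabilityMeasure_walkLaw k
    have hj := hf.isProbDensity_sumDensity hL j
    have hn := hf.isProbDensity_sumDensity hL (k + j)
    rw [walkLaw, Measure.lintegral_conv (hj.1.measurable_ofReal_sub z),
      show k + 1 + j + 1 = (k + j) + 2 by ring]
    change _ = ENNReal.ofReal (conv f (sumDensity f (k + j + 1)) z)
    rw [hf.ofReal_conv hn.1.measurable hn.1.nonneg hn.2]
    refine lintegral_congr fun a => ?_
    rw [← ih]
    simp_rw [sub_sub]

theorem IsProbDensity.lintegral_exp_abs_walkLaw_le {f : ℝ → ℝ} (hf : IsProbDensity f) {lam : ℝ}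
    (hlam : 0 ≤ lam) (k : ℕ) :
    ∫⁻ s, ENNReal.ofReal (Real.exp (lam * |s|)) ∂walkLaw f k
      ≤ (∫⁻ s, ENNReal.ofReal (Real.exp (lam * |s|)) ∂stepLaw f) ^ k := by
  have := hf.isProbabilityMeasure_walkLaw
  induction k with
  | zero => simp [walkLaw]
  | succ k ih =>
    rw [walkLaw, Measure.lintegral_conv (by fun_prop), pow_succ', ← lintegral_mul_const _
      (by fun_prop)]
    refine lintegral_mono fun a => ?_
    refine le_trans ?_ (mul_le_mul_right ih _)
    rw [← lintegral_const_mul _ (by fun_prop)]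
    refine lintegral_mono fun s => ?_
    rw [← ENNReal.ofReal_mul (Real.exp_nonneg _), ← Real.exp_add, ← mul_add]
    gcongr
    exact abs_add_le _ _

/-- If `E[φ(S_k) | S_n = z₀]` dominates `E[φ(S_k) | S_n = z]` for all `z₀` within distance `1` of a
point `c` near which `f_n ≥ δ`, averaging over `z₀` bounds it by `E[φ(S_k)] / (2 δ)`. Here
`n = k + j + 1`. -/
theorem IsProbDensity.lintegral_mul_sumDensity_le {f : ℝ → ℝ} {L : ℝ} (hf : IsProbDensity f)
    (hL : ∀ x, f x ≤ L) (k j : ℕ)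
    (hq : ∀ ⦃x x' a : ℝ⦄, x ≤ x' → 0 ≤ a → sumDensity f (j + 1) x' * sumDensity f (j + 1) (x - a)
      ≤ sumDensity f (j + 1) x * sumDensity f (j + 1) (x' - a))
    {φ : ℝ → ENNReal} (hφ : Measurable φ) {z c δ : ℝ} (hδ : 0 < δ)
    (hc : ∀ x ∈ Icc (-1 : ℝ) 1, δ ≤ sumDensity f (k + j + 1) (c + x))
    (h : (Antitone φ ∧ c + 1 ≤ z) ∨ (Monotone φ ∧ z ≤ c - 1)) :
    ∫⁻ s, φ s * ENNReal.ofReal (sumDensity f (j + 1) (z - s)) ∂walkLaw f k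
      ≤ ENNReal.ofReal (1 / (2 * δ)) * (∫⁻ s, φ s ∂walkLaw f k)
        * ENNReal.ofReal (sumDensity f (k + j + 1) z) := by
  have := hf.isProbabilityMeasure_walkLaw k
  obtain ⟨hj, -⟩ := hf.isProbDensity_sumDensity hL j
  have hjm := hj.measurable
  set N : ℝ → ENNReal := fun z =>
    ∫⁻ s, φ s * ENNReal.ofReal (sumDensity f (j + 1) (z - s)) ∂walkLaw f k with hN
  have h1 : ∀ x ∈ Icc (c - 1) (c + 1), N z * ENNReal.ofReal δ
      ≤ N x * ENNReal.ofReal (sumDensity f (k + j + 1) z) := by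
    intro x hx
    have hle := lintegral_mul_lintegral_le (ρ := walkLaw f k) hφ hj.measurable hj.nonneg hq
      (z := z) (z₀ := x) (h.imp (fun h => ⟨h.1, hx.2.trans h.2⟩) fun h => ⟨h.1, h.2.trans hx.1⟩)
    rw [hf.lintegral_sumDensity_sub_walkLaw hL, hf.lintegral_sumDensity_sub_walkLaw hL] at hle
    refine (mul_le_mul_right (ENNReal.ofReal_le_ofReal ?_) _).trans hle
    have := hc (x - c) ⟨by linarith [hx.1], by linarith [hx.2]⟩
    rwa [add_sub_cancel] at this
  have hNm : Measurable N := by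
    have : Measurable fun p : ℝ × ℝ => φ p.2 * ENNReal.ofReal (sumDensity f (j + 1) (p.1 - p.2)) :=
      by fun_prop
    exact this.lintegral_prod_right'
  have hNint : ∫⁻ x, N x = ∫⁻ s, φ s ∂walkLaw f k := by
    rw [hN, lintegral_lintegral_swap (by fun_prop)]
    refine lintegral_congr fun s => ?_
    rw [lintegral_const_mul _ (by fun_prop),
      lintegral_sub_right_eq_self (fun x => ENNReal.ofReal (sumDensity f (j + 1) x)),
      hj.lintegral_eq_one, mul_one]
  have h2 : N z * ENNReal.ofReal δ * 2
      ≤ (∫⁻ s, φ s ∂walkLaw f k) * ENNReal.ofReal (sumDensity f (k + j + 1) z) := by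
    calc N z * ENNReal.ofReal δ * 2 = ∫⁻ _ in Icc (c - 1) (c + 1), N z * ENNReal.ofReal δ := by
          rw [setLIntegral_const, Real.volume_Icc]
          congr 1
          rw [show c + 1 - (c - 1) = 2 by ring, ENNReal.ofReal_ofNat]
      _ ≤ ∫⁻ x in Icc (c - 1) (c + 1), N x * ENNReal.ofReal (sumDensity f (k + j + 1) z) :=
          setLIntegral_mono' measurableSet_Icc h1
      _ ≤ ∫⁻ x, N x * ENNReal.ofReal (sumDensity f (k + j + 1) z) := setLIntegral_le_lintegral _ _
      _ = _ := by rw [lintegral_mul_const _ hNm, hNint]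
  have h3 : ENNReal.ofReal (1 / (2 * δ)) * (ENNReal.ofReal δ * 2) = 1 := by
    rw [← ENNReal.ofReal_ofNat 2, ← ENNReal.ofReal_mul hδ.le, ← ENNReal.ofReal_mul (by positivity),
      ← ENNReal.ofReal_one]
    congr 1; field_simp
  calc N z = ENNReal.ofReal (1 / (2 * δ)) * (N z * ENNReal.ofReal δ * 2) := by
        rw [mul_assoc (N z), mul_left_comm, h3, mul_one]
    _ ≤ _ := by rw [mul_assoc (ENNReal.ofReal _)]; exact mul_le_mul_right h2 _

/-! ### The maximum of the bridge -/

theorem measurable_iSup_walkPos {n : ℕ} (z : ℝ) :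
    Measurable fun x : Fin (n - 1) → ℝ => ⨆ k : Fin n, |walkPos n z x (k.val + 1)| := by
  refine Measurable.iSup fun k => ?_
  unfold walkPos
  split_ifs <;> fun_prop

theorem IsProbDensity.lintegral_bridge_partial_sum {f : ℝ → ℝ} {L : ℝ} (hf : IsProbDensity f)
    (hL : ∀ x, f x ≤ L) {φ : ℝ → ENNReal} (hφ : Measurable φ) (z : ℝ) {k j m : ℕ}
    (hm : m = k + j) :
    ∫⁻ x : Fin m → ℝ, φ (∑ i : Fin m with i.val < k, x i) * ENNReal.ofReal (f (z - ∑ i, x i))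
        ∂Measure.pi (fun _ => stepLaw f)
      = ∫⁻ s, φ s * ENNReal.ofReal (sumDensity f (j + 1) (z - s)) ∂walkLaw f k := by
  have hfm := hf.measurable
  rw [hf.lintegral_partial_sums (H := fun s w => φ s * ENNReal.ofReal (f (z - w)))
    (by fun_prop) k j m hm]
  refine lintegral_congr fun s => ?_
  rw [lintegral_const_mul _ (by fun_prop), ← hf.lintegral_sub_walkLaw hL]
  simp_rw [sub_sub]

/-- Reversal of the walk: given `S_n = z`, the increment `z - S_k` is distributed as `S_{n-k}`.
Here `k` and `j` stand for `k + 1` and `n - k - 1`. -/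
theorem IsProbDensity.lintegral_reversal {f : ℝ → ℝ} {L : ℝ} (hf : IsProbDensity f)
    (hL : ∀ x, f x ≤ L) {φ : ℝ → ENNReal} (hφ : Measurable φ) (z : ℝ) (k j : ℕ) :
    ∫⁻ s, φ (z - s) * ENNReal.ofReal (sumDensity f (j + 1) (z - s)) ∂walkLaw f (k + 1)
      = ∫⁻ s, φ s * ENNReal.ofReal (sumDensity f (k + 1) (z - s)) ∂walkLaw f (j + 1) := by
  have hk := (hf.isProbDensity_sumDensity hL k).1
  have hj := (hf.isProbDensity_sumDensity hL j).1
  have hkm := hk.measurable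
  have hjm := hj.measurable
  rw [hf.walkLaw_succ hL, hf.walkLaw_succ hL, hk.lintegral_stepLaw (by fun_prop),
    hj.lintegral_stepLaw (by fun_prop), ← lintegral_sub_left_eq_self _ z]
  refine lintegral_congr fun s => ?_
  rw [sub_sub_cancel]
  ring

/-- Away from the centre of the walk, `E[φ(S_k) + φ(z - S_k) | S_n = z]` is controlled by the
unconditioned exponential moments. -/
theorem IsProbDensity.lintegral_bridge_add_le {f : ℝ → ℝ} {L : ℝ} (hf : IsProbDensity f)
    (hL : ∀ x, f x ≤ L)
    (hq : ∀ (j : ℕ) ⦃x x' a : ℝ⦄, x ≤ x' → 0 ≤ a →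
      sumDensity f (j + 1) x' * sumDensity f (j + 1) (x - a)
        ≤ sumDensity f (j + 1) x * sumDensity f (j + 1) (x' - a))
    {φ : ℝ → ENNReal} (hφ : Measurable φ) {lam : ℝ} (hlam : 0 ≤ lam)
    (hφ_le : ∀ s, φ s ≤ ENNReal.ofReal (Real.exp (lam * |s|)))
    {z c δ : ℝ} (hφz : φ z ≤ φ 0) (hδ : 0 < δ) {m k j : ℕ} (hm : m = k + j)
    (hc : ∀ x ∈ Icc (-1 : ℝ) 1, δ ≤ sumDensity f (m + 1) (c + x))
    (h : (Antitone φ ∧ c + 1 ≤ z) ∨ (Monotone φ ∧ z ≤ c - 1)) :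
    ∫⁻ x : Fin m → ℝ, (φ (∑ i : Fin m with i.val < k, x i)
          + φ (z - ∑ i : Fin m with i.val < k, x i)) * ENNReal.ofReal (f (z - ∑ i, x i))
        ∂Measure.pi (fun _ => stepLaw f)
      ≤ 2 * (ENNReal.ofReal (1 / (2 * δ))
        * (∫⁻ s, ENNReal.ofReal (Real.exp (lam * |s|)) ∂stepLaw f) ^ (m + 1)
        * ENNReal.ofReal (sumDensity f (m + 1) z)) := by
  have hfm := hf.measurable
  have := hf.isProbabilityMeasure
  set M := ∫⁻ s, ENNReal.ofReal (Real.exp (lam * |s|)) ∂stepLaw f with hM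
  have hM1 : 1 ≤ M := by
    rw [← measure_univ (μ := stepLaw f), ← setLIntegral_one, Measure.restrict_univ]
    refine lintegral_mono fun s => ?_
    rw [← ENNReal.ofReal_one]
    exact ENNReal.ofReal_le_ofReal (Real.one_le_exp (by positivity))
  have hmain : ∀ k j, m = k + j →
      ∫⁻ s, φ s * ENNReal.ofReal (sumDensity f (j + 1) (z - s)) ∂walkLaw f k
        ≤ ENNReal.ofReal (1 / (2 * δ)) * M ^ (m + 1)
          * ENNReal.ofReal (sumDensity f (m + 1) z) := by
    intro k j hkj
    subst hkj
    refine (hf.lintegral_mul_sumDensity_le hL k j (hq j) hφ hδ hc h).trans ?_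
    gcongr
    calc ∫⁻ s, φ s ∂walkLaw f k
        ≤ ∫⁻ s, ENNReal.ofReal (Real.exp (lam * |s|)) ∂walkLaw f k := lintegral_mono hφ_le
      _ ≤ M ^ k := hf.lintegral_exp_abs_walkLaw_le hlam k
      _ ≤ M ^ (k + j + 1) := pow_le_pow_right₀ hM1 (by omega)
  have h1 := hmain k j hm
  have h2 : ∫⁻ s, φ (z - s) * ENNReal.ofReal (sumDensity f (j + 1) (z - s)) ∂walkLaw f k
      ≤ ENNReal.ofReal (1 / (2 * δ)) * M ^ (m + 1)
          * ENNReal.ofReal (sumDensity f (m + 1) z) := by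
    rcases k with _ | k
    · refine le_trans ?_ h1
      rw [walkLaw, lintegral_dirac, lintegral_dirac, sub_zero]
      gcongr
    · rw [hf.lintegral_reversal hL hφ]
      exact hmain (j + 1) k (by omega)
  simp only [add_mul]
  rw [lintegral_add_left (by fun_prop), two_mul, hf.lintegral_bridge_partial_sum hL hφ z hm,
    hf.lintegral_bridge_partial_sum hL (φ := fun s => φ (z - s)) (by fun_prop) z hm]
  exact add_le_add h1 h2

theorem ofReal_exp_iSup_walkPos_le {m : ℕ} {z lam : ℝ} {φ : ℝ → ENNReal} {K : ENNReal}
    (hK : ∀ s, ENNReal.ofReal (Real.exp (lam * |s|)) ≤ K * (φ s + φ (z - s)))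
    (x : Fin (m + 1 - 1) → ℝ) :
    ENNReal.ofReal (Real.exp (lam * ⨆ k : Fin (m + 1), |walkPos (m + 1) z x (k.val + 1)|))
      ≤ K * ∑ k ∈ Finset.range (m + 1), (φ (∑ i : Fin (m + 1 - 1) with i.val < k, x i)
          + φ (z - ∑ i : Fin (m + 1 - 1) with i.val < k, x i)) := by
  obtain ⟨k, hk⟩ := exists_eq_ciSup_of_finite
    (f := fun k : Fin (m + 1) => |walkPos (m + 1) z x (k.val + 1)|)
  rw [← hk]
  refine (hK _).trans (mul_le_mul_right ?_ _)
  unfold walkPos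
  split_ifs with hkm
  · exact Finset.single_le_sum (f := fun k => φ (∑ i : Fin (m + 1 - 1) with i.val < k, x i)
          + φ (z - ∑ i : Fin (m + 1 - 1) with i.val < k, x i)) (fun _ _ => zero_le)
      (Finset.mem_range.2 hkm)
  · -- The endpoint `S_n = z` is covered by the term `k = 0`, in which `S_0 = 0`.
    refine le_trans ?_ (Finset.single_le_sum
      (f := fun k => φ (∑ i : Fin (m + 1 - 1) with i.val < k, x i)
          + φ (z - ∑ i : Fin (m + 1 - 1) with i.val < k, x i)) (fun _ _ => zero_le)
      (Finset.mem_range.2 m.succ_pos))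
    simp [add_comm]

/-- The exponential moment of the maximum of the bridge for an endpoint `z` away from the centre:
`max |S_k|` exceeds `|z|` by at most the largest of the negative parts of `S_k` and `z - S_k` (for
`z > 0`), and the maximum over `k` is bounded by the sum. -/
theorem IsProbDensity.bridgeExpMax_le_of_far {f : ℝ → ℝ} {L : ℝ} (hf : IsProbDensity f)
    (hL : ∀ x, f x ≤ L)
    (hq : ∀ (j : ℕ) ⦃x x' a : ℝ⦄, x ≤ x' → 0 ≤ a →
      sumDensity f (j + 1) x' * sumDensity f (j + 1) (x - a)
        ≤ sumDensity f (j + 1) x * sumDensity f (j + 1) (x' - a))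
    {lam : ℝ} (hlam : 0 ≤ lam) {z c δ : ℝ} (hδ : 0 < δ) {m : ℕ}
    (hpos : 0 < sumDensity f (m + 1) z)
    (hc : ∀ x ∈ Icc (-1 : ℝ) 1, δ ≤ sumDensity f (m + 1) (c + x))
    (h : (0 ≤ z ∧ c + 1 ≤ z) ∨ (z ≤ 0 ∧ z ≤ c - 1)) :
    bridgeExpMax f (m + 1) z lam ≤ ENNReal.ofReal (Real.exp (lam * |z|))
      * ((m + 1) * (2 * (ENNReal.ofReal (1 / (2 * δ))
        * (∫⁻ s, ENNReal.ofReal (Real.exp (lam * |s|)) ∂stepLaw f) ^ (m + 1)))) := by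
  have hfm := hf.measurable
  obtain ⟨φ, hφm, hφ, hφ_le, hφz, hK⟩ : ∃ φ : ℝ → ENNReal, Measurable φ ∧
      ((Antitone φ ∧ c + 1 ≤ z) ∨ (Monotone φ ∧ z ≤ c - 1)) ∧
      (∀ s, φ s ≤ ENNReal.ofReal (Real.exp (lam * |s|))) ∧ φ z ≤ φ 0 ∧
      ∀ s, ENNReal.ofReal (Real.exp (lam * |s|))
        ≤ ENNReal.ofReal (Real.exp (lam * |z|)) * (φ s + φ (z - s)) := by
    have hcomb : ∀ (w : ℝ → ℝ) (s : ℝ), |s| ≤ |z| + w s ∨ |s| ≤ |z| + w (z - s) →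
        ENNReal.ofReal (Real.exp (lam * |s|)) ≤ ENNReal.ofReal (Real.exp (lam * |z|))
          * (ENNReal.ofReal (Real.exp (lam * w s))
            + ENNReal.ofReal (Real.exp (lam * w (z - s)))) := by
      intro w s hs
      have hexp : ∀ u, |s| ≤ |z| + u → ENNReal.ofReal (Real.exp (lam * |s|))
          ≤ ENNReal.ofReal (Real.exp (lam * |z|)) * ENNReal.ofReal (Real.exp (lam * u)) := by
        intro u hu
        rw [← ENNReal.ofReal_mul (Real.exp_nonneg _), ← Real.exp_add, ← mul_add]
        gcongr
      rcases hs with hs | hs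
      · exact (hexp _ hs).trans (mul_le_mul_right le_self_add _)
      · exact (hexp _ hs).trans (mul_le_mul_right le_add_self _)
    have hmono : ∀ {u w : ℝ}, u ≤ w →
        ENNReal.ofReal (Real.exp (lam * u)) ≤ ENNReal.ofReal (Real.exp (lam * w)) := fun h =>
      ENNReal.ofReal_le_ofReal (Real.exp_le_exp.2 (mul_le_mul_of_nonneg_left h hlam))
    rcases h with ⟨hz0, hz⟩ | ⟨hz0, hz⟩
    · refine ⟨fun s => ENNReal.ofReal (Real.exp (lam * max (-s) 0)), by fun_prop,
        Or.inl ⟨fun s t hst => ?_, hz⟩, fun s => ?_, ?_, fun s => hcomb (fun s => max (-s) 0) s ?_⟩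
      · exact hmono (max_le_max_right _ (neg_le_neg hst))
      · exact hmono (max_le (neg_le_abs s) (abs_nonneg s))
      · exact hmono (max_le_max_right _ (neg_le_neg hz0))
      · rw [abs_of_nonneg hz0]
        rcases le_total s 0 with hs | hs
        · left; rw [abs_of_nonpos hs]; linarith [le_max_left (-s) 0]
        · right; rw [abs_of_nonneg hs]; linarith [le_max_left (-(z - s)) 0]
    · refine ⟨fun s => ENNReal.ofReal (Real.exp (lam * max s 0)), by fun_prop,
        Or.inr ⟨fun s t hst => ?_, hz⟩, fun s => ?_, ?_, fun s => hcomb (fun s => max s 0) s ?_⟩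
      · exact hmono (max_le_max_right _ hst)
      · exact hmono (max_le (le_abs_self s) (abs_nonneg s))
      · exact hmono (max_le_max_right _ hz0)
      · rw [abs_of_nonpos hz0]
        rcases le_total s 0 with hs | hs
        · right; rw [abs_of_nonpos hs]; linarith [le_max_left (z - s) 0]
        · left; rw [abs_of_nonneg hs]; linarith [le_max_left s 0]
  set M := ∫⁻ s, ENNReal.ofReal (Real.exp (lam * |s|)) ∂stepLaw f with hM
  set K := ENNReal.ofReal (Real.exp (lam * |z|)) with hKdef
  have hfz : ENNReal.ofReal (sumDensity f (m + 1) z) ≠ 0 := by simpa using hpos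
  rw [bridgeExpMax, hf.lintegral_bridgeLaw hpos
    (by have := measurable_iSup_walkPos (n := m + 1) z; fun_prop)]
  refine ENNReal.div_le_of_le_mul ?_
  calc ∫⁻ x : Fin (m + 1 - 1) → ℝ,
        ENNReal.ofReal (Real.exp (lam * ⨆ k : Fin (m + 1), |walkPos (m + 1) z x (k.val + 1)|))
          * ENNReal.ofReal (f (z - ∑ i, x i)) ∂Measure.pi (fun _ => stepLaw f)
      ≤ ∫⁻ x : Fin (m + 1 - 1) → ℝ, K * ∑ k ∈ Finset.range (m + 1),
          (φ (∑ i : Fin (m + 1 - 1) with i.val < k, x i)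
            + φ (z - ∑ i : Fin (m + 1 - 1) with i.val < k, x i))
          * ENNReal.ofReal (f (z - ∑ i, x i)) ∂Measure.pi (fun _ => stepLaw f) := by
        refine lintegral_mono fun x => ?_
        rw [← Finset.sum_mul, ← mul_assoc]
        exact mul_le_mul_left (ofReal_exp_iSup_walkPos_le hK x) _
    _ = K * ∑ k ∈ Finset.range (m + 1), ∫⁻ x : Fin (m + 1 - 1) → ℝ,
          (φ (∑ i : Fin (m + 1 - 1) with i.val < k, x i)
            + φ (z - ∑ i : Fin (m + 1 - 1) with i.val < k, x i))
          * ENNReal.ofReal (f (z - ∑ i, x i)) ∂Measure.pi (fun _ => stepLaw f) := by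
        rw [lintegral_const_mul _ (by fun_prop), lintegral_finsetSum _ (by fun_prop)]
    _ ≤ K * ∑ _k ∈ Finset.range (m + 1), 2 * (ENNReal.ofReal (1 / (2 * δ)) * M ^ (m + 1)
          * ENNReal.ofReal (sumDensity f (m + 1) z)) := by
        gcongr with k hk
        have hk' : k < m + 1 := Finset.mem_range.1 hk
        exact hf.lintegral_bridge_add_le hL hq hφm hlam hφ_le hφz hδ
          (m := m) (k := k) (j := m - k) (by omega) hc hφ
    _ = _ := by
        rw [Finset.sum_const, Finset.card_range, nsmul_eq_mul]
        push_cast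
        ring

/-- The exponential moment of the maximum of the bridge in terms of a lower bound of `f_n(z)`,
from `|S_k| ≤ |z| + |X_1| + ⋯ + |X_{n-1}|`. -/
theorem IsProbDensity.bridgeExpMax_le_of_bulk {f : ℝ → ℝ} {L : ℝ} (hf : IsProbDensity f)
    (hL : ∀ x, f x ≤ L) {lam : ℝ} (hlam : 0 ≤ lam) {z δ : ℝ} (hδ : 0 < δ) {m : ℕ}
    (hδz : δ ≤ sumDensity f (m + 1) z) :
    bridgeExpMax f (m + 1) z lam ≤ ENNReal.ofReal (Real.exp (lam * |z|))
      * ((∫⁻ s, ENNReal.ofReal (Real.exp (lam * |s|)) ∂stepLaw f) ^ m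
        * ENNReal.ofReal (L / δ)) := by
  have := hf.isProbabilityMeasure
  have hfm := hf.measurable
  have hpos := hδ.trans_le hδz
  have hexp : ∀ x : Fin m → ℝ,
      Real.exp (lam * ⨆ k : Fin (m + 1), |walkPos (m + 1) z x (k.val + 1)|)
        ≤ Real.exp (lam * |z|) * ∏ i, Real.exp (lam * |x i|) := by
    intro x
    rw [← Real.exp_sum, ← Real.exp_add, ← Finset.mul_sum, ← mul_add]
    have h0 : 0 ≤ ∑ i, |x i| := Finset.sum_nonneg fun _ _ => abs_nonneg _
    gcongr
    refine ciSup_le fun k => ?_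
    unfold walkPos
    split_ifs
    · calc |∑ i : Fin m with i.val < k.val + 1, x i|
          ≤ ∑ i : Fin m with i.val < k.val + 1, |x i| := Finset.abs_sum_le_sum_abs _ _
        _ ≤ ∑ i, |x i| := Finset.sum_le_sum_of_subset_of_nonneg (Finset.filter_subset _ _)
            fun _ _ _ => abs_nonneg _
        _ ≤ |z| + ∑ i, |x i| := le_add_of_nonneg_left (abs_nonneg z)
    · linarith
  rw [bridgeExpMax, hf.lintegral_bridgeLaw hpos
    (by have := measurable_iSup_walkPos (n := m + 1) z; fun_prop)]
  refine ENNReal.div_le_of_le_mul ?_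
  calc ∫⁻ x : Fin m → ℝ,
        ENNReal.ofReal (Real.exp (lam * ⨆ k : Fin (m + 1), |walkPos (m + 1) z x (k.val + 1)|))
          * ENNReal.ofReal (f (z - ∑ i, x i)) ∂Measure.pi (fun _ => stepLaw f)
      ≤ ∫⁻ x : Fin m → ℝ, ENNReal.ofReal (Real.exp (lam * |z|)) * ENNReal.ofReal L
          * ∏ i, ENNReal.ofReal (Real.exp (lam * |x i|)) ∂Measure.pi (fun _ => stepLaw f) := by
        refine lintegral_mono fun x => ?_
        rw [mul_right_comm, ← ENNReal.ofReal_prod_of_nonneg fun i _ => Real.exp_nonneg _,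
          ← ENNReal.ofReal_mul (p := Real.exp (lam * |z|)) (Real.exp_nonneg _)]
        refine mul_le_mul' (ENNReal.ofReal_le_ofReal (hexp x)) (ENNReal.ofReal_le_ofReal (hL _))
    _ = ENNReal.ofReal (Real.exp (lam * |z|)) * ENNReal.ofReal L
          * (∫⁻ s, ENNReal.ofReal (Real.exp (lam * |s|)) ∂stepLaw f) ^ m := by
        rw [lintegral_const_mul _ (by fun_prop),
          lintegral_pi_prod _ (u := fun t => ENNReal.ofReal (Real.exp (lam * |t|))) (by fun_prop)]
    _ ≤ _ := by
        rw [mul_assoc, mul_assoc, mul_assoc, mul_comm (ENNReal.ofReal L)]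
        gcongr
        rw [← ENNReal.ofReal_mul' (by linarith)]
        refine ENNReal.ofReal_le_ofReal ?_
        have hL0 : 0 ≤ L := (hf.nonneg 0).trans (hL 0)
        rw [div_mul_eq_mul_div, le_div_iff₀ hδ]
        gcongr

/-- Jensen's inequality for the bridge: a bound for the exponent `lam` yields one for `lam / v`. -/
theorem IsProbDensity.bridgeExpMax_div_le {f : ℝ → ℝ} {L : ℝ} (hf : IsProbDensity f)
    (hL : ∀ x, f x ≤ L) {n : ℕ} (hn : 1 ≤ n) (z lam : ℝ) {v : ℕ} (hv : 0 < v) :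
    bridgeExpMax f n z (lam / v) ≤ bridgeExpMax f n z lam ^ (1 / (v : ℝ)) := by
  have hv1 : (1 : ℝ) ≤ v := by exact_mod_cast hv
  have hm := measurable_iSup_walkPos (n := n) z
  have h := eLpNorm'_le_eLpNorm'_mul_rpow_measure_univ (μ := bridgeLaw f n z) one_pos hv1
    (f := fun x : Fin (n - 1) → ℝ =>
      Real.exp (lam / v * ⨆ k : Fin n, |walkPos n z x (k.val + 1)|))
    (Measurable.aestronglyMeasurable (by fun_prop))
  have h1 : bridgeLaw f n z univ ^ (1 / 1 - 1 / (v : ℝ)) ≤ 1 :=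
    ENNReal.rpow_le_one (hf.bridgeLaw_univ_le hL hn z)
      (sub_nonneg.2 (by rw [div_one]; exact div_le_self zero_le_one hv1))
  have h2 := h.trans (mul_le_of_le_one_right' h1)
  simp only [eLpNorm', ENNReal.rpow_one, div_one, Real.enorm_of_nonneg (Real.exp_nonneg _)] at h2
  refine h2.trans_eq (congrArg (· ^ (1 / (v : ℝ))) (lintegral_congr fun x => ?_))
  rw [ENNReal.ofReal_rpow_of_nonneg (Real.exp_nonneg _) (by positivity), ← Real.exp_mul]
  congr 2
  field_simp

/-! ### Lower bounds for the densities of the walk -/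

/-- Strongly unimodal densities are themselves unimodal: divide `F(y) - F(y - a)` by `a` and let
`a` tend to `0`. -/
theorem StronglyUnimodal.quasiConcave {f : ℝ → ℝ} (hf : IsProbDensity f) (hc : Continuous f)
    (hs : StronglyUnimodal f) : QuasiConcave f := by
  set F : ℝ → ℝ := fun y => ∫ t in Iic y, f t with hF
  have ha : ∀ n : ℕ, (0 : ℝ) < 1 / (n + 1) := fun n => by positivity
  refine QuasiConcave.of_tendsto
    (u := fun n y => (1 / ((n : ℝ) + 1))⁻¹ * (F y - 1 * F (y - 1 / ((n : ℝ) + 1)))) (fun n => ?_)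
    fun y => ?_
  · intro x y z hxy hyz
    have h := hs.quasiConcave_cdf_sub hf zero_le_one (ha n) hxy hyz
    dsimp only
    rw [← mul_min_of_nonneg _ _ (inv_nonneg.2 (ha n).le)]
    exact mul_le_mul_of_nonneg_left h (inv_nonneg.2 (ha n).le)
  · have h := ((hf.hasDerivAt_cdf hc y).tendsto_slope).comp
      (f := fun n : ℕ => y - 1 / ((n : ℝ) + 1)) (x := atTop) (by
        refine tendsto_nhdsWithin_iff.2 ⟨?_, Eventually.of_forall fun n => ?_⟩
        · simpa using (tendsto_one_div_add_atTop_nhds_zero_nat (𝕜 := ℝ)).const_sub y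
        · have := ha n
          simp only [mem_compl_iff, mem_singleton_iff]
          linarith)
    refine h.congr fun n => ?_
    have := ha n
    simp only [Function.comp, slope_def_field, hF]
    field_simp
    ring

theorem IsProbDensity.sumDensity_pos {f : ℝ → ℝ} {L : ℝ} (hf : IsProbDensity f)
    (hL : ∀ x, f x ≤ L) (hc : Continuous f) (hpos : ∀ x, 0 < f x) (n : ℕ) (x : ℝ) :
    0 < sumDensity f (n + 1) x := by
  induction n generalizing x with
  | zero => exact hpos x
  | succ n ih =>
    have hn := hf.isProbDensity_sumDensity hL n
    have hcn := hf.continuous_sumDensity hc hL n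
    change 0 < ∫ t, f t * sumDensity f (n + 1) (x - t)
    exact integral_pos_of_integrable_nonneg_nonzero (x := 0) (by fun_prop)
      (hf.integrable_conv_integrand hn.1.measurable hn.1.nonneg hn.2 x)
      (fun t => (mul_pos (hpos _) (ih _)).le) (mul_pos (hpos _) (ih _)).ne'

open ProbabilityTheory in
/-- `walkLaw f n` is the law of the sum of the first `n` coordinates of the i.i.d. sequence with law
`stepLaw f`; this is the form in which the central limit theorem applies. -/
theorem map_sum_infinitePi {f : ℝ → ℝ} (hf : IsProbDensity f) [IsProbabilityMeasure (stepLaw f)]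
    (n : ℕ) :
    (Measure.infinitePi fun _ : ℕ => stepLaw f).map (fun ω => ∑ k ∈ Finset.range n, ω k)
      = walkLaw f n := by
  have := hf.isProbabilityMeasure_walkLaw
  induction n with
  | zero => simp [walkLaw]
  | succ n ih =>
    have hind : iIndepFun (fun (i : ℕ) (ω : ℕ → ℝ) => ω i)
        (Measure.infinitePi fun _ : ℕ => stepLaw f) :=
      iIndepFun_infinitePi (X := fun _ x => x) (by fun_prop)
    have h := hind.indepFun_finsetSum_of_notMem (by fun_prop)
      (s := Finset.range n) (i := n) (by simp)
    have h2 := h.map_add_eq_map_conv_map₀ (by fun_prop) (measurable_pi_apply n).aemeasurable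
    have e1 : (∑ j ∈ Finset.range n, fun ω : ℕ → ℝ => ω j) + (fun ω => ω n)
        = fun ω => ∑ k ∈ Finset.range (n + 1), ω k := by
      ext ω; simp [Finset.sum_range_succ]
    have e2 : (∑ j ∈ Finset.range n, fun ω : ℕ → ℝ => ω j)
        = fun ω => ∑ k ∈ Finset.range n, ω k := by
      ext ω; simp
    rw [e1, e2, ih, Measure.infinitePi_map_eval (fun _ : ℕ => stepLaw f) n] at h2
    rw [h2, walkLaw, Measure.conv_comm]

theorem AssumptionC2With.integrable_exp {f : ℝ → ℝ} {lam : ℝ} (hf : IsProbDensity f)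
    (h : AssumptionC2With f lam) : Integrable fun x => Real.exp (lam * |x|) * f x := by
  have := hf.measurable
  refine ⟨by fun_prop, ?_⟩
  rw [hasFiniteIntegral_iff_ofReal
    (Eventually.of_forall fun x => mul_nonneg (Real.exp_nonneg _) (hf.nonneg x))]
  exact h.2

theorem AssumptionC2With.lintegral_stepLaw {f : ℝ → ℝ} {lam : ℝ} (hf : IsProbDensity f)
    (h : AssumptionC2With f lam) :
    ∫⁻ s, ENNReal.ofReal (Real.exp (lam * |s|)) ∂stepLaw f
      = ENNReal.ofReal (∫ x, Real.exp (lam * |x|) * f x) := by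
  rw [ofReal_integral_eq_lintegral_ofReal (h.integrable_exp hf)
    (Eventually.of_forall fun x => mul_nonneg (Real.exp_nonneg _) (hf.nonneg x)),
    hf.lintegral_stepLaw (by fun_prop)]
  refine lintegral_congr fun x => ?_
  rw [mul_comm, ← ENNReal.ofReal_mul (Real.exp_nonneg _)]

theorem AssumptionC2With.memLp_two {f : ℝ → ℝ} {lam : ℝ} (hf : IsProbDensity f)
    (h : AssumptionC2With f lam) : MemLp (fun x => x) 2 (stepLaw f) := by
  refine (memLp_two_iff_integrable_sq (by fun_prop)).2 ?_
  have hi : Integrable (fun x => Real.exp (lam * |x|)) (stepLaw f) := by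
    refine ⟨by fun_prop, ?_⟩
    rw [hasFiniteIntegral_iff_ofReal (Eventually.of_forall fun x => Real.exp_nonneg _),
      h.lintegral_stepLaw hf]
    exact ENNReal.ofReal_lt_top
  refine (hi.const_mul (2 / lam ^ 2)).mono' (by fun_prop) (Eventually.of_forall fun x => ?_)
  have hl := h.1
  have h1 := Real.quadratic_le_exp_of_nonneg (x := lam * |x|) (by positivity)
  have h2 : 0 ≤ lam * |x| := by positivity
  rw [Real.norm_of_nonneg (sq_nonneg x), div_mul_eq_mul_div, le_div_iff₀ (by positivity)]
  nlinarith [sq_abs x]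

theorem IsProbDensity.integral_stepLaw {f : ℝ → ℝ} (hf : IsProbDensity f) :
    ∫ x, x ∂stepLaw f = mean f := by
  rw [stepLaw, integral_withDensity_eq_integral_toReal_smul hf.measurable_ofReal
    (Eventually.of_forall fun _ => ENNReal.ofReal_lt_top), mean]
  congr 1; ext x
  rw [ENNReal.toReal_ofReal (hf.nonneg x), smul_eq_mul, mul_comm]

open ProbabilityTheory in
theorem IsProbDensity.variance_ne_zero {f : ℝ → ℝ} (hf : IsProbDensity f)
    (h2 : MemLp (fun x => x) 2 (stepLaw f)) : Var[fun x => x; stepLaw f] ≠ 0 := by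
  have := hf.isProbabilityMeasure
  intro h
  have hae := ae_eq_integral_of_variance_eq_zero h2 h
  have h0 : stepLaw f {∫ x, x ∂stepLaw f} = 0 :=
    withDensity_absolutelyContinuous _ _ (measure_singleton _)
  have h1 := prob_add_prob_compl (μ := stepLaw f) (measurableSet_singleton (∫ x, x ∂stepLaw f))
  rw [h0, zero_add] at h1
  have h3 : stepLaw f {∫ x, x ∂stepLaw f}ᶜ = 0 := hae
  rw [h3] at h1
  exact zero_ne_one h1

open ProbabilityTheory in
/-- By the central limit theorem, `S_n - n μ` lies in the scaled interval `√n (a, b)` with a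
probability that stays away from `0`. -/
theorem IsProbDensity.exists_eventually_lt_walkLaw {f : ℝ → ℝ} (hf : IsProbDensity f)
    (h2 : MemLp (fun x => x) 2 (stepLaw f)) {a b : ℝ} (hab : a < b) :
    ∃ δ : ℝ, 0 < δ ∧ ∀ᶠ n : ℕ in atTop,
      ENNReal.ofReal δ < walkLaw f n {y | (√(n : ℝ))⁻¹ * (y - n * mean f) ∈ Ioo a b} := by
  have := hf.isProbabilityMeasure
  set P := Measure.infinitePi fun _ : ℕ => stepLaw f with hP
  set X : ℕ → (ℕ → ℝ) → ℝ := fun i ω => ω i with hX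
  have hmap : ∀ i, P.map (X i) = stepLaw f := fun i =>
    Measure.infinitePi_map_eval (fun _ : ℕ => stepLaw f) i
  have hind : iIndepFun X P := iIndepFun_infinitePi (X := fun _ x => x) (by fun_prop)
  have hident : ∀ i, IdentDistrib (X i) (X 0) P P := fun i =>
    ⟨by fun_prop, by fun_prop, by rw [hmap, hmap]⟩
  have hid : IdentDistrib (X 0) (fun x => x) P (stepLaw f) :=
    ⟨by fun_prop, by fun_prop, by rw [hmap]; simp⟩
  have hvar : Var[X 0; P] ≠ 0 := by
    rw [hid.variance_eq]; exact hf.variance_ne_zero h2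
  have hmean : P[X 0] = mean f := by rw [hid.integral_eq, hf.integral_stepLaw]
  set v := Var[X 0; P].toNNReal with hv
  have hv0 : v ≠ 0 := by
    rw [hv, Ne, Real.toNNReal_eq_zero, not_le]
    exact lt_of_le_of_ne (variance_nonneg _ _) hvar.symm
  have hclt := (tendstoInDistribution_inv_sqrt_mul_sum_sub (P' := gaussianReal 0 v)
    (Y := fun y => y) ⟨by fun_prop, by simp [hv]⟩ (hid.memLp_iff.2 h2) hind hident).tendsto
  have hopen := ProbabilityMeasure.le_liminf_measure_open_of_tendsto hclt
    (G := Ioo a b) isOpen_Ioo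
  have hg : 0 < gaussianReal 0 v (Ioo a b) := by
    refine pos_iff_ne_zero.2 fun h0 => ?_
    have := gaussianReal_absolutelyContinuous' 0 hv0 h0
    rw [Real.volume_Ioo, ENNReal.ofReal_eq_zero] at this
    linarith
  obtain ⟨δ, hδ0, hδ⟩ := ENNReal.lt_iff_exists_real_btwn.1 hg
  have hδpos : 0 < δ := ENNReal.ofReal_pos.1 hδ.1
  refine ⟨δ, hδpos, ?_⟩
  have hlt := lt_of_lt_of_le (by simpa using hδ.2) hopen
  filter_upwards [eventually_lt_of_lt_liminf hlt] with n hn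
  refine hn.trans_eq ?_
  have hm : Measurable fun ω : ℕ → ℝ => ∑ k ∈ Finset.range n, ω k := by fun_prop
  have hs : MeasurableSet {y : ℝ | (√(n : ℝ))⁻¹ * (y - n * mean f) ∈ Ioo a b} :=
    measurableSet_Ioo.preimage (f := fun y : ℝ => (√(n : ℝ))⁻¹ * (y - n * mean f)) (by fun_prop)
  rw [← map_sum_infinitePi hf n, Measure.map_apply hm hs, ← hP]
  simp only [ProbabilityMeasure.coe_mk, hmean]
  rw [Measure.map_apply (by fun_prop) measurableSet_Ioo]
  rfl

/-- An interval of length `(b - a) √n` with mass more than `δ` contains a point where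
`f_n ≥ δ / ((b - a) √n)`. -/
theorem IsProbDensity.exists_le_sumDensity {f : ℝ → ℝ} {L : ℝ} (hf : IsProbDensity f)
    (hL : ∀ x, f x ≤ L) {a b δ : ℝ} (hab : b - a = 1) (hδ : 0 < δ) {n : ℕ} (hn : 1 ≤ n) {c : ℝ}
    (h : ENNReal.ofReal δ < walkLaw f n {y | (√(n : ℝ))⁻¹ * (y - c) ∈ Ioo a b}) :
    ∃ y, c + a * √n < y ∧ y < c + b * √n ∧ δ / √n ≤ sumDensity f n y := by
  obtain ⟨n, rfl⟩ : ∃ m, n = m + 1 := ⟨n - 1, by omega⟩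
  by_contra! hcon
  have hs : 0 < √((n + 1 : ℕ) : ℝ) := Real.sqrt_pos.2 (by positivity)
  set s := √((n + 1 : ℕ) : ℝ) with hsdef
  have hset : {y : ℝ | s⁻¹ * (y - c) ∈ Ioo a b} = Ioo (c + a * s) (c + b * s) := by
    ext y
    simp only [mem_ofPred_eq, mem_Ioo]
    rw [inv_mul_eq_div, lt_div_iff₀ hs, div_lt_iff₀ hs]
    constructor <;> rintro ⟨h1, h2⟩ <;> constructor <;> linarith
  rw [hset, hf.walkLaw_succ hL, stepLaw, withDensity_apply _ measurableSet_Ioo] at h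
  refine absurd h (not_lt.2 ?_)
  calc ∫⁻ y in Ioo (c + a * s) (c + b * s), ENNReal.ofReal (sumDensity f (n + 1) y)
      ≤ ∫⁻ _ in Ioo (c + a * s) (c + b * s), ENNReal.ofReal (δ / s) :=
        setLIntegral_mono' measurableSet_Ioo fun y hy =>
          ENNReal.ofReal_le_ofReal (hcon y hy.1 hy.2).le
    _ = ENNReal.ofReal δ := by
        rw [setLIntegral_const, Real.volume_Ioo, ← ENNReal.ofReal_mul (by positivity)]
        congr 1
        rw [show c + b * s - (c + a * s) = (b - a) * s by ring, hab]
        field_simp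

/-- The density of `S_n` is at least of order `n^{-1/2}` within distance `1` of the mean. By the
central limit theorem `f_n` is that large somewhere in `n μ + √n (1, 2)` and somewhere in
`n μ + √n (-2, -1)`, hence also in between because it is unimodal. -/
theorem StronglyUnimodal.exists_center_lower {f : ℝ → ℝ} {L : ℝ} (hf : IsProbDensity f)
    (hL : ∀ x, f x ≤ L) (hc : Continuous f) (hpos : ∀ x, 0 < f x) (hs : StronglyUnimodal f)
    (h2 : MemLp (fun x => x) 2 (stepLaw f)) :
    ∃ Δ : ℝ, 0 < Δ ∧ ∀ n : ℕ, 1 ≤ n → ∀ x ∈ Icc (-1 : ℝ) 1,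
      Δ / √(n : ℝ) ≤ sumDensity f n (n * mean f + x) := by
  obtain ⟨δ₁, hδ₁, h₁⟩ := hf.exists_eventually_lt_walkLaw h2 (one_lt_two (α := ℝ))
  obtain ⟨δ₂, hδ₂, h₂⟩ := hf.exists_eventually_lt_walkLaw h2 (show (-2 : ℝ) < -1 by norm_num)
  obtain ⟨N, hN⟩ := eventually_atTop.1 (h₁.and h₂)
  have hbig : ∀ n : ℕ, 1 ≤ n → N ≤ n → ∀ x ∈ Icc (-1 : ℝ) 1,
      min δ₁ δ₂ / √(n : ℝ) ≤ sumDensity f n (n * mean f + x) := by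
    intro n hn hNn x hx
    obtain ⟨y₁, hy₁, -, hfy₁⟩ := hf.exists_le_sumDensity hL (by norm_num) hδ₁ hn (hN n hNn).1
    obtain ⟨y₂, -, hy₂, hfy₂⟩ := hf.exists_le_sumDensity hL (by norm_num) hδ₂ hn (hN n hNn).2
    have hsq : 1 ≤ √(n : ℝ) := Real.one_le_sqrt.2 (by exact_mod_cast hn)
    obtain ⟨m, rfl⟩ : ∃ m, n = m + 1 := ⟨n - 1, by omega⟩
    have hqc := (stronglyUnimodal_sumDensity hf hL hs m).quasiConcave
      (hf.isProbDensity_sumDensity hL m).1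
      (hf.continuous_sumDensity hc hL m)
    refine le_trans (le_min ?_ ?_) (hqc (x := y₂) (z := y₁) (by linarith [hx.1])
      (by linarith [hx.2]))
    · exact le_trans (by gcongr; exact min_le_right _ _) hfy₂
    · exact le_trans (by gcongr; exact min_le_left _ _) hfy₁
  -- The finitely many small `n` are treated by compactness.
  have hsmall : ∀ K : ℕ, ∃ Δ : ℝ, 0 < Δ ∧ ∀ n : ℕ, 1 ≤ n → n ≤ K → ∀ x ∈ Icc (-1 : ℝ) 1,
      Δ / √(n : ℝ) ≤ sumDensity f n (n * mean f + x) := by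
    intro K
    induction K with
    | zero => exact ⟨1, one_pos, fun n h1 h0 => absurd h1 (by omega)⟩
    | succ K ih =>
      obtain ⟨Δ, hΔ, hK⟩ := ih
      have hcK := hf.continuous_sumDensity hc hL K
      obtain ⟨y, -, hy⟩ := (isCompact_Icc (a := (-1 : ℝ)) (b := 1)).exists_isMinOn
        (nonempty_Icc.2 (by norm_num))
        (f := fun x => sumDensity f (K + 1) ((K + 1 : ℕ) * mean f + x)) (by fun_prop)
      have hy0 := hf.sumDensity_pos hL hc hpos K ((K + 1 : ℕ) * mean f + y)
      have hsq : 0 < √((K + 1 : ℕ) : ℝ) := Real.sqrt_pos.2 (by positivity)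
      refine ⟨min Δ (sumDensity f (K + 1) ((K + 1 : ℕ) * mean f + y) * √((K + 1 : ℕ) : ℝ)),
        lt_min hΔ (by positivity), fun n h1 hn x hx => ?_⟩
      rcases Nat.lt_or_ge K n with h | h
      · obtain rfl : n = K + 1 := by omega
        refine le_trans ?_ (hy hx)
        rw [div_le_iff₀ hsq]
        exact min_le_right _ _
      · exact le_trans (by gcongr; exact min_le_left _ _) (hK n h1 h x hx)
  obtain ⟨Δ, hΔ, hK⟩ := hsmall N
  refine ⟨min Δ (min δ₁ δ₂), by positivity, fun n hn x hx => ?_⟩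
  rcases le_total n N with h | h
  · exact le_trans (by gcongr; exact min_le_left _ _) (hK n hn h x hx)
  · exact le_trans (div_le_div_of_nonneg_right (min_le_right _ _) (by positivity))
      (hbig n hn h x hx)

/-- If `f ≥ m` on `[-(r + 1), r + 1]` then `f_n ≥ m ^ n` on `[-r n, r n]`: keep the first step near
the average step. -/
theorem IsProbDensity.pow_le_sumDensity {f : ℝ → ℝ} {L m r : ℝ} (hf : IsProbDensity f)
    (hL : ∀ x, f x ≤ L) (hr : 1 ≤ r) (hm0 : 0 ≤ m)
    (hm : ∀ x ∈ Icc (-(r + 1)) (r + 1), m ≤ f x) (n : ℕ) {x : ℝ} (hx : |x| ≤ r * (n + 1)) :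
    m ^ (n + 1) ≤ sumDensity f (n + 1) x := by
  induction n generalizing x with
  | zero =>
    rw [zero_add, pow_one]
    rw [abs_le] at hx
    push_cast at hx
    exact hm x ⟨by linarith [hx.1], by linarith [hx.2]⟩
  | succ n ih =>
    have hn := hf.isProbDensity_sumDensity hL n
    have hi := hf.integrable_conv_integrand hn.1.measurable hn.1.nonneg hn.2 x
    obtain ⟨w, hw⟩ : ∃ w : ℝ, ∀ t ∈ Icc w (w + 1), |t| ≤ r + 1 ∧ |x - t| ≤ r * (n + 1) := by
      have hn0 : (0 : ℝ) ≤ n := n.cast_nonneg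
      push_cast at hx
      set u := x / (n + 2) with hu
      have hxu : x = u * (n + 2) := by rw [hu]; field_simp
      have hur : |u| ≤ r := by
        rw [hu, abs_div, abs_of_pos (by linarith : (0 : ℝ) < n + 2), div_le_iff₀ (by linarith)]
        linarith
      have hrn : 1 ≤ r * (n + 1) := by nlinarith
      rw [abs_le] at hur
      rcases le_total 0 u with h0 | h0
      · have h1 : 0 ≤ u * (n + 1) := by positivity
        have h2 : u * (n + 1) ≤ r * (n + 1) := by gcongr; exact hur.2
        refine ⟨u, fun t ht => ⟨abs_le.2 ⟨by linarith [ht.1], by linarith [ht.2]⟩,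
          abs_le.2 ⟨?_, ?_⟩⟩⟩
        · rw [hxu]; linarith [ht.2]
        · rw [hxu]; linarith [ht.1]
      · have h1 : u * (n + 1) ≤ 0 := mul_nonpos_of_nonpos_of_nonneg h0 (by positivity)
        have h2 : -r * (n + 1) ≤ u * (n + 1) := by gcongr; exact hur.1
        refine ⟨u - 1, fun t ht => ⟨abs_le.2 ⟨by linarith [ht.1], by linarith [ht.2]⟩,
          abs_le.2 ⟨?_, ?_⟩⟩⟩
        · rw [hxu]; linarith [ht.2]
        · rw [hxu]; linarith [ht.1]
    change m ^ (n + 1 + 1) ≤ ∫ t, f t * sumDensity f (n + 1) (x - t)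
    calc m ^ (n + 1 + 1) = ∫ _ in Icc w (w + 1), m * m ^ (n + 1) := by
          rw [setIntegral_const, Measure.real, Real.volume_Icc]
          simp [pow_succ']
      _ ≤ ∫ t in Icc w (w + 1), f t * sumDensity f (n + 1) (x - t) := by
          refine setIntegral_mono_on (integrableOn_const (by simp)) hi.integrableOn
            measurableSet_Icc fun t ht => ?_
          have h := hw t ht
          exact mul_le_mul (hm t (abs_le.1 h.1)) (ih h.2) (by positivity) (hf.nonneg t)
      _ ≤ ∫ t, f t * sumDensity f (n + 1) (x - t) :=
          setIntegral_le_integral hi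
            (Eventually.of_forall fun t => mul_nonneg (hf.nonneg t) (hn.1.nonneg _))

/-! ### The strongly unimodal case -/

theorem one_le_integral_exp {f : ℝ → ℝ} {lam : ℝ} (hf : IsProbDensity f)
    (h : AssumptionC2With f lam) : 1 ≤ ∫ x, Real.exp (lam * |x|) * f x := by
  rw [← hf.integral_eq_one]
  refine integral_mono hf.integrable (h.integrable_exp hf) fun x => ?_
  have := h.1
  exact le_mul_of_one_le_left (hf.nonneg x) (Real.one_le_exp (by positivity))

theorem StronglyUnimodal.exists_unimodalConstants {f : ℝ → ℝ} {lam L : ℝ} (hf : IsProbDensity f)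
    (hc : Continuous f) (hpos : ∀ x, 0 < f x) (hs : StronglyUnimodal f)
    (h2 : AssumptionC2With f lam) (hL0 : 0 < L) (hL : ∀ x, f x ≤ L) :
    ∃ Δ R C c CHat cHat : ℝ, UnimodalConstants f lam L Δ R C c CHat cHat := by
  obtain ⟨Δ, hΔ, hcenter⟩ := hs.exists_center_lower hf hL hc hpos (h2.memLp_two hf)
  set R := |mean f| + 1 + Δ⁻¹ + 1 with hR
  have hR1 : 1 ≤ 2 * R := by
    have := abs_nonneg (mean f)
    have : 0 < Δ⁻¹ := inv_pos.2 hΔ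
    linarith
  obtain ⟨y, -, hy⟩ := (isCompact_Icc (a := -(2 * R + 1)) (b := 2 * R + 1)).exists_isMinOn
    (nonempty_Icc.2 (by linarith)) hc.continuousOn
  set m := min (f y) 1 with hm
  have hm0 : 0 < m := lt_min (hpos y) one_pos
  have hlog : Real.log m ≤ 0 := Real.log_nonpos hm0.le (min_le_right _ _)
  set c := 1 - Real.log m with hcdef
  set A := ∫ x, Real.exp (lam * |x|) * f x with hA
  have hA1 : 1 ≤ A := one_le_integral_exp hf h2
  have hsqrt : ∀ n : ℕ, 1 ≤ n → 1 ≤ √(n : ℝ) := fun n hn =>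
    Real.one_le_sqrt.2 (by exact_mod_cast hn)
  refine ⟨Δ, R, 1, c, 4 / Δ + L, A + 2 + c, hΔ, hcenter, by linarith, one_pos, by linarith, ?_, ?_⟩
  · intro n hn z hz
    have h1 : 1 / √(n : ℝ) * Real.exp (-(c * n)) ≤ m ^ n := by
      calc 1 / √(n : ℝ) * Real.exp (-(c * n)) ≤ 1 * Real.exp (n * Real.log m) := by
            gcongr
            · exact (div_le_one (by linarith [hsqrt n hn])).2 (hsqrt n hn)
            · rw [hcdef]; nlinarith [(n.cast_nonneg : (0 : ℝ) ≤ n)]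
        _ = m ^ n := by rw [one_mul, mul_comm, Real.exp_mul, Real.exp_log hm0, Real.rpow_natCast]
    refine h1.trans ?_
    obtain ⟨k, rfl⟩ : ∃ k, n = k + 1 := ⟨n - 1, by omega⟩
    refine hf.pow_le_sumDensity hL hR1 hm0.le (fun x hx => (min_le_left _ _).trans (hy hx)) k ?_
    rw [abs_mul, mul_comm]
    push_cast
    rw [abs_of_pos (by positivity : (0 : ℝ) < k + 1)]
    gcongr
    exact abs_le.2 hz
  · intro n hn
    have hn1 : (1 : ℝ) ≤ n := by exact_mod_cast hn
    have hne : (n : ℝ) ≤ Real.exp n := by linarith [Real.add_one_le_exp (n : ℝ)]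
    have hAn : A ^ n ≤ Real.exp (A * n) := by
      rw [Real.exp_mul, Real.rpow_natCast]
      gcongr
      linarith [Real.add_one_le_exp A]
    have h32 : (n : ℝ) ^ (3 / 2 : ℝ) ≤ Real.exp ((2 + c) * n) := by
      calc (n : ℝ) ^ (3 / 2 : ℝ) ≤ (n : ℝ) ^ (2 : ℝ) :=
            Real.rpow_le_rpow_of_exponent_le hn1 (by norm_num)
        _ ≤ Real.exp n ^ (2 : ℝ) := by gcongr
        _ ≤ Real.exp ((2 + c) * n) := by
            rw [← Real.exp_mul]
            refine Real.exp_le_exp.2 ?_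
            nlinarith
    have h12 : √(n : ℝ) * Real.exp (c * n) ≤ Real.exp ((2 + c) * n) := by
      calc √(n : ℝ) * Real.exp (c * n) ≤ Real.exp n * Real.exp (c * n) := by
            gcongr
            refine le_trans ?_ hne
            rw [Real.sqrt_le_left (by linarith)]
            nlinarith
        _ ≤ Real.exp ((2 + c) * n) := by
            rw [← Real.exp_add]
            gcongr
            nlinarith
    calc A ^ n * (4 * (n : ℝ) ^ (3 / 2 : ℝ) / Δ + L * 1⁻¹ * √(n : ℝ) * Real.exp (c * n))
        = A ^ n * (4 / Δ * (n : ℝ) ^ (3 / 2 : ℝ) + L * (√(n : ℝ) * Real.exp (c * n))) := by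
          rw [inv_one]; ring
      _ ≤ Real.exp (A * n) * (4 / Δ * Real.exp ((2 + c) * n) + L * Real.exp ((2 + c) * n)) := by
          gcongr
      _ = (4 / Δ + L) * Real.exp ((A + 2 + c) * n) := by
          rw [add_assoc A, add_mul A, Real.exp_add]; ring

theorem UnimodalConstants.CHat_pos {f : ℝ → ℝ} {lam L Δ R C c CHat cHat : ℝ}
    (hf : IsProbDensity f) (h2 : AssumptionC2With f lam) (hL0 : 0 < L)
    (h : UnimodalConstants f lam L Δ R C c CHat cHat) : 0 < CHat := by
  have hA := one_le_integral_exp hf h2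
  have hC := h.C_pos
  have hΔ := h.Δ_pos
  have h1 := h.upper 1 le_rfl
  have h3 : 0 < CHat * Real.exp (cHat * (1 : ℕ)) := lt_of_lt_of_le (by positivity) h1
  exact pos_of_mul_pos_left h3 (Real.exp_nonneg _)

/-- The exponential moment of `max |S_k|` on the bridge, for the full exponent `lam`: the bulk lower
bound of `f_n` serves for `|z| ≤ 2 R n`, log-concavity of the `f_j` serves for the other endpoints,
which lie at distance at least `1` from the mean `n μ`. -/
theorem StronglyUnimodal.bridgeExpMax_le {f : ℝ → ℝ} {lam L Δ R C c CHat cHat : ℝ}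
    (hf : IsProbDensity f) (hc : Continuous f) (hpos : ∀ x, 0 < f x) (hs : StronglyUnimodal f)
    (h2 : AssumptionC2With f lam) (hL0 : 0 < L) (hL : ∀ x, f x ≤ L)
    (h : UnimodalConstants f lam L Δ R C c CHat cHat) {n : ℕ} (hn : 1 ≤ n) (z : ℝ) :
    bridgeExpMax f n z lam
      ≤ ENNReal.ofReal (Real.exp (lam * |z|) * (CHat * Real.exp (cHat * n))) := by
  have hA := one_le_integral_exp hf h2
  have hC := h.C_pos
  have hΔ := h.Δ_pos
  have hup := h.upper n hn
  have hn0 : (0 : ℝ) < n := by exact_mod_cast hn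
  have hM := h2.lintegral_stepLaw hf
  set A := ∫ x, Real.exp (lam * |x|) * f x with hAdef
  have hsq : 0 < √(n : ℝ) := Real.sqrt_pos.2 hn0
  rw [ENNReal.ofReal_mul (Real.exp_nonneg _)]
  obtain ⟨m, rfl⟩ : ∃ m, n = m + 1 := ⟨n - 1, by omega⟩
  rcases le_or_gt |z| (2 * R * (m + 1 : ℕ)) with hz | hz
  · have hb : C / √((m + 1 : ℕ) : ℝ) * Real.exp (-(c * (m + 1 : ℕ))) ≤ sumDensity f (m + 1) z := by
      have := h.bulk_lower (m + 1) hn (z / (m + 1 : ℕ)) (abs_le.1 (by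
        rw [abs_div, abs_of_pos hn0, div_le_iff₀ hn0]; exact hz))
      rwa [mul_div_cancel₀ _ hn0.ne'] at this
    refine (hf.bridgeExpMax_le_of_bulk hL h2.1.le (by positivity) hb).trans ?_
    rw [hM, ← ENNReal.ofReal_pow (by linarith), ← ENNReal.ofReal_mul (by positivity)]
    refine mul_le_mul_right (ENNReal.ofReal_le_ofReal (le_trans ?_ hup)) _
    have hdiv : L / (C / √((m + 1 : ℕ) : ℝ) * Real.exp (-(c * (m + 1 : ℕ))))
        = L * C⁻¹ * √((m + 1 : ℕ) : ℝ) * Real.exp (c * (m + 1 : ℕ)) := by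
      rw [Real.exp_neg]; field_simp
    rw [hdiv]
    exact mul_le_mul (pow_le_pow_right₀ hA m.le_succ) (le_add_of_nonneg_left (by positivity))
      (by positivity) (by positivity)
  · have hcen := h.center_lower (m + 1) hn
    have hRn : |((m + 1 : ℕ) : ℝ) * mean f| + 1 ≤ 2 * R * (m + 1 : ℕ) := by
      have hR := h.R_gt
      have : 0 < Δ⁻¹ := inv_pos.2 hΔ
      have h1 : (1 : ℝ) ≤ (m + 1 : ℕ) := by exact_mod_cast hn
      rw [abs_mul, abs_of_pos hn0]
      nlinarith [abs_nonneg (mean f)]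
    have hle := le_abs_self (((m + 1 : ℕ) : ℝ) * mean f)
    have hge := neg_abs_le (((m + 1 : ℕ) : ℝ) * mean f)
    have hfar : (0 ≤ z ∧ ((m + 1 : ℕ) : ℝ) * mean f + 1 ≤ z)
        ∨ (z ≤ 0 ∧ z ≤ ((m + 1 : ℕ) : ℝ) * mean f - 1) := by
      rcases le_total 0 z with h0 | h0
      · rw [abs_of_nonneg h0] at hz
        exact Or.inl ⟨h0, by linarith⟩
      · rw [abs_of_nonpos h0] at hz
        exact Or.inr ⟨h0, by linarith⟩
    refine (hf.bridgeExpMax_le_of_far hL (fun j x x' a hx ha =>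
        (stronglyUnimodal_sumDensity hf hL hs j).logConcave (hf.isProbDensity_sumDensity hL j).1
          (hf.continuous_sumDensity hc hL j) (hf.sumDensity_pos hL hc hpos j) hx ha)
      h2.1.le (by positivity) (hf.sumDensity_pos hL hc hpos m z) hcen hfar).trans ?_
    have hcast : ((m : ENNReal) + 1) * (2 * (ENNReal.ofReal
          (1 / (2 * (Δ / √((m + 1 : ℕ) : ℝ)))) * ENNReal.ofReal A ^ (m + 1)))
        = ENNReal.ofReal (A ^ (m + 1) * ((m + 1 : ℕ) * √((m + 1 : ℕ) : ℝ) / Δ)) := by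
      rw [← ENNReal.ofReal_pow (by linarith), ← ENNReal.ofReal_mul (by positivity),
        ← ENNReal.ofReal_ofNat 2, ← ENNReal.ofReal_mul (by positivity),
        show (m : ENNReal) + 1 = ((m + 1 : ℕ) : ENNReal) by push_cast; rfl,
        ← ENNReal.ofReal_natCast, ← ENNReal.ofReal_mul (by positivity)]
      congr 1; field_simp
    rw [hM, hcast]
    refine mul_le_mul_right (ENNReal.ofReal_le_ofReal (le_trans ?_ hup)) _
    have h32 : ((m + 1 : ℕ) : ℝ) ^ (3 / 2 : ℝ) = (m + 1 : ℕ) * √((m + 1 : ℕ) : ℝ) := by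
      rw [show (3 / 2 : ℝ) = 1 + 1 / 2 by norm_num, Real.rpow_add hn0, Real.rpow_one,
        Real.sqrt_eq_rpow]
    rw [h32]
    refine mul_le_mul_of_nonneg_left ?_ (by positivity)
    have h3 : 0 ≤ L * C⁻¹ * √((m + 1 : ℕ) : ℝ) * Real.exp (c * (m + 1 : ℕ)) := by positivity
    have h4 : ((m + 1 : ℕ) : ℝ) * √((m + 1 : ℕ) : ℝ) / Δ
        ≤ 4 * ((m + 1 : ℕ) * √((m + 1 : ℕ) : ℝ)) / Δ := by
      exact div_le_div_of_nonneg_right (by linarith [mul_pos hn0 hsq]) hΔ.le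
    linarith

theorem StronglyUnimodal.assumptionC6With {f : ℝ → ℝ} {α β : EReal}
    {lam L Δ R C c CHat cHat : ℝ}
    (hf : IsProbDensity f) (hc : Continuous f) (hpos : ∀ x, 0 < f x) (hs : StronglyUnimodal f)
    (h2 : AssumptionC2With f lam) (hL0 : 0 < L) (hL : ∀ x, f x ≤ L)
    (h : UnimodalConstants f lam L Δ R C c CHat cHat) {v : ℝ → ℕ}
    (hv : ∀ b : ℝ, 0 < b → 0 < v b ∧ cHat / v b ≤ b / 2 ∧ lam / v b ≤ b / 2) :
    AssumptionC6With f α β (fun b => lam / v b) (fun b => CHat ^ (1 / (v b : ℝ))) := by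
  have hCHat := h.CHat_pos hf h2 hL0
  refine ⟨fun b hb => ⟨div_pos h2.1 (by exact_mod_cast (hv b hb).1), by positivity⟩, ?_⟩
  intro n hn z _ b hb
  obtain ⟨hv0, hv1, hv2⟩ := hv b hb
  have hv0' : (0 : ℝ) < v b := by exact_mod_cast hv0
  have hn0 : (0 : ℝ) < n := by exact_mod_cast hn
  refine (hf.bridgeExpMax_div_le hL hn z lam hv0).trans ?_
  refine (ENNReal.rpow_le_rpow (hs.bridgeExpMax_le hf hc hpos h2 hL0 hL h hn z)
    (by positivity)).trans ?_
  rw [ENNReal.ofReal_rpow_of_nonneg (by positivity) (by positivity)]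
  refine ENNReal.ofReal_le_ofReal ?_
  rw [mul_left_comm, ← Real.exp_add, Real.mul_rpow hCHat.le (Real.exp_nonneg _), ← Real.exp_mul]
  refine mul_le_mul_of_nonneg_left (Real.exp_le_exp.2 ?_) (by positivity)
  have h1 := two_mul_abs_le hn z
  have h0 : 0 ≤ z ^ 2 / n := by positivity
  calc (lam * |z| + cHat * n) * (1 / (v b : ℝ)) = lam / v b * |z| + cHat / v b * n := by ring
    _ ≤ b / 2 * |z| + b / 2 * n := by gcongr
    _ ≤ b * (n + z ^ 2 / n) := by nlinarith [mul_nonneg hb.le h0, mul_nonneg hb.le hn0.le]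

end RWBridge

theorem lemma7p1 (f : ℝ → ℝ) (α β : EReal) (hf : RWBridge.IsProbDensity f)
    (h1 : RWBridge.AssumptionC1 f α β) (h2 : RWBridge.AssumptionC2 f)
    (h3 : RWBridge.AssumptionC3 f) (h4 : RWBridge.AssumptionC4 f)
    (h5 : RWBridge.AssumptionC5 f) :
    (α ≠ ⊥ ∨ β ≠ ⊤ ∨ (α = ⊥ ∧ β = ⊤ ∧ RWBridge.StronglyUnimodal f) →
      RWBridge.AssumptionC6 f α β) ∧
    (∀ a : ℝ, α = (a : EReal) →
      RWBridge.AssumptionC6With f α β (fun b => b / (1 + b + |a|)) (fun _ => 1)) ∧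
    (∀ a : ℝ, β = (a : EReal) →
      RWBridge.AssumptionC6With f α β (fun b => b / (1 + b + |a|)) (fun _ => 1)) ∧
    (α = ⊥ → β = ⊤ → RWBridge.StronglyUnimodal f →
      ∀ lam L : ℝ, RWBridge.AssumptionC2With f lam → RWBridge.AssumptionC5With f L →
        (∃ Δ R C c CHat cHat : ℝ, RWBridge.UnimodalConstants f lam L Δ R C c CHat cHat) ∧
        ∀ Δ R C c CHat cHat : ℝ, RWBridge.UnimodalConstants f lam L Δ R C c CHat cHat →
          ∀ v : ℝ → ℕ,
            (∀ b : ℝ, 0 < b → 0 < v b ∧ cHat / v b ≤ b / 2 ∧ lam / v b ≤ b / 2) →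
            RWBridge.AssumptionC6With f α β (fun b => lam / v b)
              (fun b => CHat ^ (1 / (v b : ℝ)))) := by
  obtain ⟨L₀, hL5⟩ := h5
  have hL := hL5.2.1
  have hsupp : ∀ y : ℝ, f y ≠ 0 → α < (y : EReal) ∧ (y : EReal) < β := fun y hy =>
    not_not.1 fun hn => hy (h1.zero_outside y hn)
  have hα : ∀ a : ℝ, α = (a : EReal) →
      RWBridge.AssumptionC6With f α β (fun b => b / (1 + b + |a|)) (fun _ => 1) := by
    intro a ha
    refine ⟨fun b hb => ⟨by positivity, one_pos⟩, fun n hn z _ b hb => ?_⟩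
    refine hf.bridgeExpMax_le_of_bounded_side hL (abs_nonneg a) (Or.inl fun y hy => ?_) hn z hb
    have := (hsupp y hy).1
    rw [ha, EReal.coe_lt_coe_iff] at this
    linarith [neg_abs_le a]
  have hβ : ∀ a : ℝ, β = (a : EReal) →
      RWBridge.AssumptionC6With f α β (fun b => b / (1 + b + |a|)) (fun _ => 1) := by
    intro a ha
    refine ⟨fun b hb => ⟨by positivity, one_pos⟩, fun n hn z _ b hb => ?_⟩
    refine hf.bridgeExpMax_le_of_bounded_side hL (abs_nonneg a) (Or.inr fun y hy => ?_) hn z hb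
    have := (hsupp y hy).2
    rw [ha, EReal.coe_lt_coe_iff] at this
    linarith [le_abs_self a]
  have huni : α = ⊥ → β = ⊤ → RWBridge.StronglyUnimodal f →
      ∀ lam L : ℝ, RWBridge.AssumptionC2With f lam → RWBridge.AssumptionC5With f L →
        (∃ Δ R C c CHat cHat : ℝ, RWBridge.UnimodalConstants f lam L Δ R C c CHat cHat) ∧
        ∀ Δ R C c CHat cHat : ℝ, RWBridge.UnimodalConstants f lam L Δ R C c CHat cHat →
          ∀ v : ℝ → ℕ,
            (∀ b : ℝ, 0 < b → 0 < v b ∧ cHat / v b ≤ b / 2 ∧ lam / v b ≤ b / 2) →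
            RWBridge.AssumptionC6With f α β (fun b => lam / v b)
              (fun b => CHat ^ (1 / (v b : ℝ))) := by
    intro ha hb hs lam L hlam hLL
    have hpos : ∀ x, 0 < f x := fun x =>
      h1.pos x (ha ▸ EReal.bot_lt_coe x) (hb ▸ EReal.coe_lt_top x)
    have hc : Continuous f := by
      rw [← continuousOn_univ]
      refine h1.continuousOn.mono fun x _ => ?_
      exact ⟨ha ▸ EReal.bot_lt_coe x, hb ▸ EReal.coe_lt_top x⟩
    exact ⟨hs.exists_unimodalConstants hf hc hpos hlam hLL.1 hLL.2.1,
      fun Δ R C c CHat cHat h v hv => hs.assumptionC6With hf hc hpos hlam hLL.1 hLL.2.1 h hv⟩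
  refine ⟨?_, hα, hβ, huni⟩
  rintro (h | h | ⟨ha, hb, hs⟩)
  · exact ⟨_, _, hα α.toReal (EReal.coe_toReal (h1.lt.trans_le le_top).ne h).symm⟩
  · exact ⟨_, _, hβ β.toReal (EReal.coe_toReal h (bot_le.trans_lt h1.lt).ne').symm⟩
  · obtain ⟨lam, hlam⟩ := h2
    obtain ⟨⟨Δ, R, C, c, CHat, cHat, hconst⟩, h6⟩ := huni ha hb hs lam L₀ hlam hL5
    -- Any positive integer `v b ≥ 2 max(cHat, lam) / b` is admissible.
    refine ⟨_, _, h6 Δ R C c CHat cHat hconst (fun b => ⌈2 * max cHat lam / b⌉₊) fun b hb => ?_⟩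
    have hpos : 0 < 2 * max cHat lam / b := by
      have := hlam.1.trans_le (le_max_right cHat lam)
      positivity
    have hv : 0 < ⌈2 * max cHat lam / b⌉₊ := Nat.ceil_pos.2 hpos
    have hv' : (0 : ℝ) < ⌈2 * max cHat lam / b⌉₊ := by exact_mod_cast hv
    have hle := Nat.le_ceil (2 * max cHat lam / b)
    rw [div_le_iff₀ hb] at hle
    refine ⟨hv, ?_, ?_⟩
    · rw [div_le_iff₀ hv']
      linarith [le_max_left cHat lam]
    · rw [div_le_iff₀ hv']
      linarith [le_max_right cHat lam]
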